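/- \textbf{Setting.} Let $\nu_y$ be a $\sigma$-finite measure on $\mathbb R$ and $f(y,h)=\exp\{a(h)y+b(h)+c(y)\}$, where $a,b:\mathbb R\to\mathbb R$ are continuously differentiable, $a'(h)\neq 0$ for all $h$, $c$ is measurable, and $\int f(y,h)\,\nu_y(dy)=1$ for every $h\in\mathbb R$. Put $\psi=-b'/a'$ and $D(R)=1+R\,\sup_{|h|\le R}|a'(h)|\,\sup_{|h|\le R}|\psi(h)|$. For each $n$ let $K_n$ be a natural number, $\nu_x$ (depending on $n$) a probability measure on $\mathbb R^{K_n}$ under which $|x_j|\le 1$ for all $j$ almost surely, and $\beta^*\in\mathbb R^{K_n}$ (the entries may depend on $n$; in particular $\beta^*$ may consist of the first $K_n$ terms of a fixed sequence). Suppose that $\lim_{n\to\infty}\sum_{j=1}^{K_n}|\beta_j^*|$ exists and is finite. The true density is $p^*(y,x)=f(y,x^T\beta^*)$ with respect to $\nu_x(dx)\nu_y(dy)$, and the data $D^n=(x^{(i)},y^{(i)})_{i=1}^n$ are i.i.d. from it; $P^*$ and $E^*$ denote probability and expectation for $D^n$. A prior $\pi=\pi_n$ is a probability measure on pairs $(\gamma,\beta_\gamma)$,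 with $\gamma\subseteq\{1,\dots,K_n\}$ and $\beta_\gamma\in\mathbb R^{\gamma}$. With $p(y,x|\gamma,\beta_\gamma)=f(y,x_\gamma^T\beta_\gamma)$, the posterior is $$\pi(d(\gamma,\beta_\gamma)|D^n)\propto\prod_{i=1}^n p(y^{(i)},x^{(i)}|\gamma,\beta_\gamma)\,\pi(d(\gamma,\beta_\gamma)).$$ Let $d(p,p^*)^2=\iint|p(y,x|\gamma,\beta_\gamma)^{1/2}-p^*(y,x)^{1/2}|^2\,\nu_y(dy)\,\nu_x(dx)$, let $|\gamma|$ be the number of elements of $\gamma$, and write $u_n\prec v_n$ for $u_n/v_n\to0$. Let $\varepsilon_n\in(0,1]$ with $n\varepsilon_n^2\to\infty$. \textbf{Condition (N).} There are nonempty models $\gamma_n$ such that $\sum_{j\notin\gamma_n}|\beta_j^*|\prec\varepsilon_n^2$ and, for every sufficiently small $\eta>0$, for all $n$ larger than some $N_\eta$, $$\pi(\gamma=\gamma_n)\ge e^{-n\varepsilon_n^2/8},\qquad \pi\bigl(|\beta_j-\beta_j^*|<\eta\varepsilon_n^2/|\gamma_n|\ \ \forall j\in\gamma_n\,\big|\,\gamma=\gamma_n\bigr)\ge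 e^{-n\varepsilon_n^2/8}.$$ \textbf{Condition (O).} There are $C_n>0$ and $\bar r_n$ with $1\le\bar r_n<K_n$ such that $\bar r_n\ln(1/\varepsilon_n^2)\prec n\varepsilon_n^2$, $\bar r_n\ln K_n\prec n\varepsilon_n^2$, $\bar r_n\ln D(\bar r_nC_n)\prec n\varepsilon_n^2$, and, for all large enough $n$, $\pi(|\gamma|>\bar r_n)\le e^{-4n\varepsilon_n^2}$ and $\pi(|\beta_j|>C_n\,|\,\gamma)\le e^{-4n\varepsilon_n^2}$ for all $\gamma$ with $|\gamma|\le\bar r_n$ (and positive prior probability) and all $j\in\gamma$. \textbf{Theorem 4 (Convergence rate under general prior).} If the prior satisfies Conditions (N) and (O), then: (i) $\lim_{n\to\infty}P^*\bigl\{\pi[d(p,p^*)\le4\varepsilon_n|D^n]\ge1-2e^{-n\varepsilon_n^2/4}\bigr\}=1$; (ii) for all sufficiently large $n$, $P^*\bigl\{\pi[d(p,p^*)>4\varepsilon_n|D^n]\ge2e^{-n\varepsilon_n^2/4}\bigr\}\le2e^{-n\varepsilon_n^2/4}$; (iii) for all sufficiently large $n$, $E^*\,\pi[d(p,p^*)>4\varepsilon_n|D^n]\le4e^{-n\varepsilon_n^2/2}$.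 -/

import Mathlib

open MeasureTheory Filter Topology

noncomputable section

/-- A one-parameter generalized linear model: with respect to the dominating measure `ν` on the
response space, the conditional density of `y` at the linear parameter `h` is
`exp (a h * y + b h + c y)`, where `a`, `b` are continuously differentiable and `a'` never vanishes.
There are no further parameters. -/
structure GLM where
  a : ℝ → ℝ
  b : ℝ → ℝ
  c : ℝ → ℝ
  ν : Measure ℝ
  sigmaFinite_ν : SigmaFinite ν
  contDiff_a : ContDiff ℝ 1 a
  contDiff_b : ContDiff ℝ 1 b
  deriv_a_ne_zero : ∀ h, deriv a h ≠ 0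
  measurable_c : Measurable c
  /-- `exp (a h * y + b h + c y)` is a probability density for every `h`. -/
  lintegral_density : ∀ h, ∫⁻ y, ENNReal.ofReal (Real.exp (a h * y + b h + c y)) ∂ν = 1

attribute [instance] GLM.sigmaFinite_ν

namespace GLM

/-- The density `f(y, h)`. -/
def f (M : GLM) (y h : ℝ) : ℝ := Real.exp (M.a h * y + M.b h + M.c y)

/-- The mean function `ψ = - b' / a'`. -/
def ψ (M : GLM) (h : ℝ) : ℝ := -deriv M.b h / deriv M.a h

/-- `D(R) = 1 + R * sup_{|h| ≤ R} |a'(h)| * sup_{|h| ≤ R} |ψ(h)|`. -/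
def D (M : GLM) (R : ℝ) : ℝ :=
  1 + R * (⨆ h : Set.Icc (-R) R, |deriv M.a h|) * (⨆ h : Set.Icc (-R) R, |M.ψ h|)

end GLM

/-- A point of the parameter space with `K` covariates: a model `γ` (a set of indices) together
with the vector `β_γ` of its regression coefficients. -/
abbrev Param (K : ℕ) : Type := Σ γ : Finset (Fin K), (γ → ℝ)

/-- The full coefficient vector: `β_γ` extended by zero outside `γ`. -/
def Param.coef {K : ℕ} (θ : Param K) (j : Fin K) : ℝ :=
  if h : j ∈ θ.1 then θ.2 ⟨j, h⟩ else 0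

/-- The linear parameter `xᵀ β`. -/
def linPred {K : ℕ} (x β : Fin K → ℝ) : ℝ := ∑ j, x j * β j

namespace GLM

/-- The joint density of `(x, y)` with respect to `νx.prod M.ν`, for the coefficient vector `β`. -/
def density (M : GLM) {K : ℕ} (β : Fin K → ℝ) (z : (Fin K → ℝ) × ℝ) : ℝ :=
  M.f z.2 (linPred z.1 β)

/-- The Hellinger distance between the densities with coefficient vectors `β` and `β'`. -/
def hellinger (M : GLM) {K : ℕ} (νx : Measure (Fin K → ℝ)) (β β' : Fin K → ℝ) : ℝ :=
  √(∫ z, (√(M.density β z) - √(M.density β' z)) ^ 2 ∂(νx.prod M.ν))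

/-- The law of `n` i.i.d. observations `(x, y)` when the coefficient vector is `β`. -/
def dataLaw (M : GLM) {K : ℕ} (νx : Measure (Fin K → ℝ)) (β : Fin K → ℝ) (n : ℕ) :
    Measure (Fin n → (Fin K → ℝ) × ℝ) :=
  Measure.pi fun _ => (νx.prod M.ν).withDensity fun z => ENNReal.ofReal (M.density β z)

/-- The likelihood of the parameter `θ` on the data set `w`. -/
def likelihood (M : GLM) {K n : ℕ} (w : Fin n → (Fin K → ℝ) × ℝ) (θ : Param K) : ENNReal :=
  ∏ i, ENNReal.ofReal (M.density θ.coef (w i))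

/-- The posterior on the parameters `(γ, β_γ)` given the data set `w`. -/
def posterior (M : GLM) {K n : ℕ} (prior : Measure (Param K)) (w : Fin n → (Fin K → ℝ) × ℝ) :
    Measure (Param K) :=
  (∫⁻ θ, M.likelihood w θ ∂prior)⁻¹ • prior.withDensity (M.likelihood w)

end GLM

/-- `u ≺ v`: the ratio `u n / v n` tends to zero. -/
def Prec (u v : ℕ → ℝ) : Prop := Tendsto (fun n => u n / v n) atTop (𝓝 0)

/-- The event that the selected model is `γ`. -/
def modelEvent {K : ℕ} (γ : Finset (Fin K)) : Set (Param K) := {θ | θ.1 = γ}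

/-- Condition (N): the prior puts enough mass on an approximation neighborhood of the truth. -/
def ConditionN {K : ℕ → ℕ} (βstar : ∀ n, Fin (K n) → ℝ) (prior : ∀ n, Measure (Param (K n)))
    (ε : ℕ → ℝ) : Prop :=
  ∃ γ : ∀ n, Finset (Fin (K n)), (∀ n, (γ n).Nonempty) ∧
    Prec (fun n => ∑ j ∈ (γ n)ᶜ, |βstar n j|) (fun n => ε n ^ 2) ∧
    ∃ η₀ > 0, ∀ η : ℝ, 0 < η → η < η₀ → ∃ N : ℕ, ∀ n > N,
      ENNReal.ofReal (Real.exp (-(n * ε n ^ 2) / 8)) ≤ prior n (modelEvent (γ n)) ∧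
      ENNReal.ofReal (Real.exp (-(n * ε n ^ 2) / 8)) ≤
        ProbabilityTheory.cond (prior n) (modelEvent (γ n))
          {θ | ∀ j ∈ γ n, |θ.coef j - βstar n j| < η * ε n ^ 2 / (γ n).card}

/-- Condition (O): the prior puts little mass outside a region that is not too complex. -/
def ConditionO (M : GLM) {K : ℕ → ℕ} (prior : ∀ n, Measure (Param (K n))) (ε : ℕ → ℝ) : Prop :=
  ∃ C r : ℕ → ℝ, (∀ n, 0 < C n) ∧ (∀ n, 1 ≤ r n ∧ r n < K n) ∧
    Prec (fun n => r n * Real.log (1 / ε n ^ 2)) (fun n => n * ε n ^ 2) ∧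
    Prec (fun n => r n * Real.log (K n)) (fun n => n * ε n ^ 2) ∧
    Prec (fun n => r n * Real.log (M.D (r n * C n))) (fun n => n * ε n ^ 2) ∧
    ∀ᶠ n : ℕ in atTop,
      prior n {θ | r n < (θ.1.card : ℝ)} ≤ ENNReal.ofReal (Real.exp (-4 * (n * ε n ^ 2))) ∧
      ∀ γ : Finset (Fin (K n)), (γ.card : ℝ) ≤ r n → ∀ j ∈ γ,
        ProbabilityTheory.cond (prior n) (modelEvent γ) {θ | C n < |θ.coef j|} ≤
          ENNReal.ofReal (Real.exp (-4 * (n * ε n ^ 2)))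

end

open scoped ENNReal

/-! Dividing every likelihood by that of the truth leaves the posterior unchanged, so the posterior
mass of a set is `U / Z`, where `Z` is the prior integral of the likelihood ratio and `U` is its
integral over the set. Write `t = n ε²`. No tests are constructed: the expectation of `U / Z` is
bounded directly, after splitting at the level `Z = e^{-t}`.

Where `Z` is below the level, `U / Z ≤ e^{-t} / Z`. By Cauchy-Schwarz, `E[1 / Z]` is at most
`e^{t/2}` as soon as the prior gives mass `e^{-t/4}` to parameters whose inverse ratio has mean at
most `e^{ε²/4}` (`lintegral_inv_lintegral_prod_le`). Where `Z` is above the level, the part of `U`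
outside a sieve has expectation equal to its prior mass, at most `e^{-3t}`. The sieve itself is cut
into at most `e^t` cells; there `U / Z ≤ 1` is replaced by its square root, so that only the mean
square root of the integrated ratio over a cell is needed.

That mean is the heart of the matter (`lintegral_sqrt_setLIntegral_prod_le`). A cell that meets the
bad set contains a density with affinity at most `1 - 8 ε²` to the truth, and every density of the
cell has affinity at least `1 - ε²/2` to it. Concavity of the square root extends the second bound
to every mixture over the cell, so each observation contributes a factor `e^{-7ε²/2}`, however the
earlier observations have reweighted the cell. Altogether the cells contribute `e^{t/2} e^t
e^{-7t/2} = e^{-2t}`.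

In the exponential family, `√(f f')` and `f₀² / f` are, up to a constant, again members of the
family, because `a` attains the required values. Their integrals are exponentials of differences of
`b`, hence controlled linearly in the distance of the linear parameters. This is why neighbourhoods
have size `ε²` and why `D`, which bounds `|b'| = |a' ψ|`, governs the number of cells. Markov's
inequality turns (iii) into (ii), and (i) follows. -/

noncomputable section

/-! ### Square roots of extended nonnegative numbers -/

namespace ENNReal

theorem rpow_half_mul_self (a : ℝ≥0∞) : a ^ (1 / 2 : ℝ) * a ^ (1 / 2 : ℝ) = a := by
  rw [← ENNReal.rpow_add_of_nonneg _ _ (by norm_num) (by norm_num)]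
  norm_num

theorem rpow_half_ofReal (a : ℝ) : ENNReal.ofReal a ^ (1 / 2 : ℝ) = ENNReal.ofReal √a := by
  rcases le_total 0 a with ha | ha
  · rw [ENNReal.ofReal_rpow_of_nonneg ha (by norm_num), Real.sqrt_eq_rpow]
  · rw [ENNReal.ofReal_of_nonpos ha, Real.sqrt_eq_zero_of_nonpos ha]
    simp

/-- The expansion of `0 ≤ (√a - 2 √b + 1) ^ 2`. -/
theorem affinity_pointwise_le (a b : ℝ≥0∞) :
    4 * (a * b) ^ (1 / 2 : ℝ) + 4 * b ^ (1 / 2 : ℝ) ≤ a + 4 * b + 1 + 2 * a ^ (1 / 2 : ℝ) := by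
  rcases eq_or_ne a ∞ with rfl | ha
  · simp
  rcases eq_or_ne b ∞ with rfl | hb
  · simp [ENNReal.mul_top]
  rw [ENNReal.mul_rpow_of_nonneg _ _ (by norm_num)]
  have ha' : a ^ (1 / 2 : ℝ) ≠ ∞ := ENNReal.rpow_ne_top_of_nonneg (by norm_num) ha
  have hb' : b ^ (1 / 2 : ℝ) ≠ ∞ := ENNReal.rpow_ne_top_of_nonneg (by norm_num) hb
  have ha2 := rpow_half_mul_self a
  have hb2 := rpow_half_mul_self b
  obtain ⟨x, hx⟩ : ∃ x : NNReal, (x : ℝ≥0∞) = a ^ (1 / 2 : ℝ) := ⟨_, ENNReal.coe_toNNReal ha'⟩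
  obtain ⟨y, hy⟩ : ∃ y : NNReal, (y : ℝ≥0∞) = b ^ (1 / 2 : ℝ) := ⟨_, ENNReal.coe_toNNReal hb'⟩
  rw [← hx] at ha2 ⊢
  rw [← hy] at hb2 ⊢
  rw [← ha2, ← hb2]
  norm_cast
  rw [← NNReal.coe_le_coe]
  push_cast
  nlinarith [sq_nonneg ((x : ℝ) - 2 * y + 1)]

theorem rpow_half_sum_le {ι : Type*} (s : Finset ι) (f : ι → ℝ≥0∞) :
    (∑ i ∈ s, f i) ^ (1 / 2 : ℝ) ≤ ∑ i ∈ s, f i ^ (1 / 2 : ℝ) := by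
  classical
  induction s using Finset.induction_on with
  | empty => simp
  | insert i s hi ih =>
    rw [Finset.sum_insert hi, Finset.sum_insert hi]
    exact (ENNReal.rpow_add_le_add_rpow _ _ (by norm_num) (by norm_num)).trans (by gcongr)

end ENNReal

/-! ### Affinities of mixtures and of integrated likelihood ratios -/

namespace MeasureTheory

variable {X Θ : Type*} [MeasurableSpace X] [MeasurableSpace Θ]

theorem lintegral_pi_succ (P : Measure X) [SigmaFinite P] (n : ℕ) {F : (Fin (n + 1) → X) → ℝ≥0∞}
    (hF : Measurable F) :
    ∫⁻ w, F w ∂(Measure.pi fun _ : Fin (n + 1) => P) =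
      ∫⁻ w, ∫⁻ x, F (Fin.cons x w) ∂P ∂(Measure.pi fun _ : Fin n => P) := by
  have h := (measurePreserving_piFinSuccAbove (fun _ : Fin (n + 1) => P) 0).symm
  rw [← h.lintegral_comp hF, lintegral_prod_symm']
  · simp_rw [MeasurableEquiv.piFinSuccAbove_symm_apply, Fin.insertNthEquiv, Equiv.coe_fn_mk,
      Fin.insertNth_zero]
    rfl
  · exact hF.comp (MeasurableEquiv.measurable _)

theorem lintegral_pi_prod (P : Measure X) [SigmaFinite P] (n : ℕ) {f : X → ℝ≥0∞}
    (hf : Measurable f) :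
    ∫⁻ w, ∏ i, f (w i) ∂(Measure.pi fun _ : Fin n => P) = (∫⁻ x, f x ∂P) ^ n := by
  induction n with
  | zero => simp
  | succ n ih =>
    rw [lintegral_pi_succ P n (by fun_prop)]
    simp_rw [Fin.prod_univ_succ, Fin.cons_zero, Fin.cons_succ]
    simp_rw [lintegral_mul_const _ hf]
    rw [lintegral_const_mul _ (by fun_prop), ih, pow_succ, mul_comm]

/-- The Cauchy-Schwarz inequality. -/
theorem lintegral_sqrt_mul_le (Q : Measure Θ) {f g : Θ → ℝ≥0∞} (hf : Measurable f)
    (hg : Measurable g) :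
    ∫⁻ θ, f θ ^ (1 / 2 : ℝ) * g θ ^ (1 / 2 : ℝ) ∂Q ≤
      (∫⁻ θ, f θ ∂Q) ^ (1 / 2 : ℝ) * (∫⁻ θ, g θ ∂Q) ^ (1 / 2 : ℝ) := by
  have h := ENNReal.lintegral_mul_le_Lp_mul_Lq Q (p := 2) (q := 2)
    Real.HolderConjugate.two_two (hf.pow_const (1 / 2 : ℝ)).aemeasurable
    (hg.pow_const (1 / 2 : ℝ)).aemeasurable
  have h2 : ∀ a : ℝ≥0∞, (a ^ (1 / 2 : ℝ)) ^ (2 : ℝ) = a := fun a => by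
    rw [← ENNReal.rpow_mul]
    norm_num
  simpa only [h2, Pi.mul_apply] using h

theorem lintegral_sqrt_le_sqrt_lintegral (Q : Measure Θ) [IsProbabilityMeasure Q] {f : Θ → ℝ≥0∞}
    (hf : Measurable f) :
    ∫⁻ θ, f θ ^ (1 / 2 : ℝ) ∂Q ≤ (∫⁻ θ, f θ ∂Q) ^ (1 / 2 : ℝ) := by
  simpa using lintegral_sqrt_mul_le Q hf (measurable_const (a := 1))

/-- Cauchy-Schwarz for `1 = √f · √(1/f)`; it bounds the inverse of an integral by the integral of
the inverse. -/
theorem sq_measure_le_lintegral_mul_lintegral_inv (Q : Measure Θ) {f : Θ → ℝ≥0∞}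
    (hf : Measurable f) (h0 : ∀ θ, f θ ≠ 0) (htop : ∀ θ, f θ ≠ ∞) :
    Q Set.univ ^ 2 ≤ (∫⁻ θ, f θ ∂Q) * ∫⁻ θ, (f θ)⁻¹ ∂Q := by
  have h := lintegral_sqrt_mul_le Q hf hf.inv
  have h1 : ∀ θ, f θ ^ (1 / 2 : ℝ) * (f⁻¹) θ ^ (1 / 2 : ℝ) = 1 := fun θ => by
    rw [← ENNReal.mul_rpow_of_nonneg _ _ (by norm_num), Pi.inv_apply,
      ENNReal.mul_inv_cancel (h0 θ) (htop θ), ENNReal.one_rpow]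
  simp_rw [h1] at h
  rw [lintegral_one] at h
  calc Q Set.univ ^ 2 ≤ ((∫⁻ θ, f θ ∂Q) ^ (1 / 2 : ℝ) * (∫⁻ θ, (f θ)⁻¹ ∂Q) ^ (1 / 2 : ℝ)) ^ 2 := by
        gcongr
        exact h
    _ = _ := by
        rw [mul_pow, pow_two, pow_two, ENNReal.rpow_half_mul_self, ENNReal.rpow_half_mul_self]

/-- If all components of a mixture have affinity at least `1 - κ` with a density `g₀` whose affinity
with the reference density `1` is at most `τ`, then the affinity of the mixture with the reference
density is at most `(1 + τ) / 2 + κ`. -/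
theorem lintegral_sqrt_mixture_le (P : Measure X) [IsProbabilityMeasure P] (Q : Measure Θ)
    [IsProbabilityMeasure Q] {g : Θ → X → ℝ≥0∞} (hg : Measurable (Function.uncurry g))
    (hg1 : ∀ θ, ∫⁻ x, g θ x ∂P = 1) {g₀ : X → ℝ≥0∞} (hg₀ : Measurable g₀)
    (hg₀1 : ∫⁻ x, g₀ x ∂P = 1) {κ τ : ℝ}
    (haff : ∀ᵐ θ ∂Q, ENNReal.ofReal (1 - κ) ≤ ∫⁻ x, (g₀ x * g θ x) ^ (1 / 2 : ℝ) ∂P)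
    (hτ : (∫⁻ x, g₀ x ^ (1 / 2 : ℝ) ∂P).toReal ≤ τ) :
    ∫⁻ x, (∫⁻ θ, g θ x ∂Q) ^ (1 / 2 : ℝ) ∂P ≤ ENNReal.ofReal ((1 + τ) / 2 + κ) := by
  have hgθ : ∀ θ, Measurable (g θ) := fun θ => hg.of_uncurry_left
  have hgx : ∀ x, Measurable fun θ => g θ x := fun x => hg.of_uncurry_right
  set G : X → ℝ≥0∞ := fun x => ∫⁻ θ, g θ x ∂Q with hG
  have hGm : Measurable G := hg.lintegral_prod_left
  have hG1 : ∫⁻ x, G x ∂P = 1 := by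
    rw [lintegral_lintegral_swap (f := fun x θ => g θ x) (hg.comp measurable_swap).aemeasurable]
    simp [hg1]
  -- By concavity of the square root, the mixture `G` is at least as close in affinity to `g₀` as
  -- its components are on average.
  have hlow : ENNReal.ofReal (1 - κ) ≤ ∫⁻ x, (g₀ x * G x) ^ (1 / 2 : ℝ) ∂P := by
    calc ENNReal.ofReal (1 - κ) = ∫⁻ _, ENNReal.ofReal (1 - κ) ∂Q := by simp
      _ ≤ ∫⁻ θ, ∫⁻ x, (g₀ x * g θ x) ^ (1 / 2 : ℝ) ∂P ∂Q := lintegral_mono_ae haff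
      _ = ∫⁻ x, ∫⁻ θ, (g₀ x * g θ x) ^ (1 / 2 : ℝ) ∂Q ∂P := by
          refine lintegral_lintegral_swap (Measurable.aemeasurable ?_)
          exact ((hg₀.comp measurable_snd).mul hg).pow_const _
      _ ≤ ∫⁻ x, (g₀ x * G x) ^ (1 / 2 : ℝ) ∂P := by
          refine lintegral_mono fun x => ?_
          refine (lintegral_sqrt_le_sqrt_lintegral Q ((hgx x).const_mul _)).trans ?_
          rw [lintegral_const_mul _ (hgx x)]
  have hle1 : ∀ {f : X → ℝ≥0∞}, Measurable f → ∫⁻ x, f x ∂P = 1 →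
      ∫⁻ x, f x ^ (1 / 2 : ℝ) ∂P ≤ 1 := fun hf h1 => by
    simpa [h1] using lintegral_sqrt_le_sqrt_lintegral P hf
  have hA : ∫⁻ x, (g₀ x * G x) ^ (1 / 2 : ℝ) ∂P ≤ 1 := by
    simp_rw [ENNReal.mul_rpow_of_nonneg _ _ (show (0 : ℝ) ≤ 1 / 2 by norm_num)]
    simpa [hg₀1, hG1] using lintegral_sqrt_mul_le P hg₀ hGm
  have hmain : 4 * ∫⁻ x, (g₀ x * G x) ^ (1 / 2 : ℝ) ∂P + 4 * ∫⁻ x, G x ^ (1 / 2 : ℝ) ∂P ≤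
      6 + 2 * ∫⁻ x, g₀ x ^ (1 / 2 : ℝ) ∂P := by
    have := lintegral_mono (μ := P) fun x => ENNReal.affinity_pointwise_le (g₀ x) (G x)
    rw [lintegral_add_left (by fun_prop), lintegral_const_mul _ (by fun_prop),
      lintegral_const_mul _ (by fun_prop), lintegral_add_left (by fun_prop),
      lintegral_add_left (by fun_prop), lintegral_add_left (by fun_prop),
      lintegral_const_mul _ (by fun_prop), lintegral_const_mul _ (by fun_prop), hg₀1, hG1,
      lintegral_one, measure_univ] at this
    refine this.trans (le_of_eq ?_)
    norm_num
  have hGle := hle1 hGm hG1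
  have hg₀le := hle1 hg₀ hg₀1
  set A := ∫⁻ x, (g₀ x * G x) ^ (1 / 2 : ℝ) ∂P
  set Y := ∫⁻ x, G x ^ (1 / 2 : ℝ) ∂P
  set Z := ∫⁻ x, g₀ x ^ (1 / 2 : ℝ) ∂P
  have hAt : A ≠ ∞ := ne_top_of_le_ne_top ENNReal.one_ne_top hA
  have hYt : Y ≠ ∞ := ne_top_of_le_ne_top ENNReal.one_ne_top hGle
  have hZt : Z ≠ ∞ := ne_top_of_le_ne_top ENNReal.one_ne_top hg₀le
  have hA' : 1 - κ ≤ A.toReal := (ENNReal.ofReal_le_iff_le_toReal hAt).1 hlow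
  have hm := ENNReal.toReal_mono (by finiteness) hmain
  rw [ENNReal.toReal_add (by finiteness) (by finiteness),
    ENNReal.toReal_add (by finiteness) (by finiteness)] at hm
  simp only [ENNReal.toReal_mul, ENNReal.toReal_ofNat] at hm
  rw [← ENNReal.ofReal_toReal hYt]
  apply ENNReal.ofReal_le_ofReal
  linarith

theorem measurable_uncurry_prod {g : Θ → X → ℝ≥0∞} (hg : Measurable (Function.uncurry g)) (n : ℕ) :
    Measurable (Function.uncurry fun (θ : Θ) (w : Fin n → X) => ∏ i, g θ (w i)) :=
  Finset.measurable_fun_prod _ fun i _ =>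
    hg.comp (measurable_fst.prodMk ((measurable_pi_apply i).comp measurable_snd))

/-- Iterating a bound on the affinity of one-step mixtures gives a bound for `n` observations. -/
theorem lintegral_sqrt_mixture_pi_le (P : Measure X) [IsProbabilityMeasure P] (Q : Measure Θ)
    [IsFiniteMeasure Q] {g : Θ → X → ℝ≥0∞} (hg : Measurable (Function.uncurry g)) (ρ : ℝ≥0∞)
    (h : ∀ Q' : Measure Θ, Q' ≪ Q → SFinite Q' →
      ∫⁻ x, (∫⁻ θ, g θ x ∂Q') ^ (1 / 2 : ℝ) ∂P ≤ ρ * Q' Set.univ ^ (1 / 2 : ℝ)) (n : ℕ) :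
    ∫⁻ w, (∫⁻ θ, ∏ i, g θ (w i) ∂Q) ^ (1 / 2 : ℝ) ∂(Measure.pi fun _ : Fin n => P) ≤
      ρ ^ n * Q Set.univ ^ (1 / 2 : ℝ) := by
  have hgx : ∀ x, Measurable fun θ => g θ x := fun x => hg.of_uncurry_right
  have hprod := measurable_uncurry_prod hg
  induction n with
  | zero => simp
  | succ n ih =>
    rw [lintegral_pi_succ P n ((hprod (n + 1)).lintegral_prod_left.pow_const _)]
    calc _ ≤ ∫⁻ w, ρ * (∫⁻ θ, ∏ i, g θ (w i) ∂Q) ^ (1 / 2 : ℝ)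
          ∂(Measure.pi fun _ : Fin n => P) := by
          refine lintegral_mono fun w => ?_
          have hw : Measurable fun θ => ∏ i, g θ (w i) := (hprod n).of_uncurry_right
          -- The first `n` observations only reweight the mixing measure; the remaining one is a
          -- one-step mixture for the reweighted measure, which is why the hypothesis ranges over
          -- all `Q' ≪ Q`.
          have := h (Q.withDensity fun θ => ∏ i, g θ (w i))
            (withDensity_absolutelyContinuous _ _) inferInstance
          rw [withDensity_apply _ MeasurableSet.univ, Measure.restrict_univ] at this
          refine le_trans (le_of_eq ?_) this
          refine lintegral_congr fun x => ?_
          rw [lintegral_withDensity_eq_lintegral_mul _ hw (hgx x)]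
          simp_rw [Fin.prod_univ_succ, Fin.cons_zero, Fin.cons_succ, Pi.mul_apply, mul_comm]
      _ ≤ _ := by
          rw [lintegral_const_mul _ ((hprod n).lintegral_prod_left.pow_const _), pow_succ',
            mul_assoc]
          gcongr

/-- A set of densities that are close to a density `g₀`, which is itself far from the truth,
accumulates an exponentially small amount of integrated likelihood ratio. -/
theorem lintegral_sqrt_setLIntegral_prod_le (P : Measure X) [IsProbabilityMeasure P] (π : Measure Θ)
    [IsProbabilityMeasure π] {g : Θ → X → ℝ≥0∞} (hg : Measurable (Function.uncurry g))
    (hg1 : ∀ θ, ∫⁻ x, g θ x ∂P = 1) {S : Set Θ} (hS : MeasurableSet S) {θ₀ : Θ} {κ τ : ℝ}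
    (haff : ∀ θ ∈ S, ENNReal.ofReal (1 - κ) ≤ ∫⁻ x, (g θ₀ x * g θ x) ^ (1 / 2 : ℝ) ∂P)
    (hτ : (∫⁻ x, g θ₀ x ^ (1 / 2 : ℝ) ∂P).toReal ≤ τ) {ρ : ℝ} (hρ0 : 0 < ρ)
    (hρ : (1 + τ) / 2 + κ ≤ ρ) (n : ℕ) :
    ∫⁻ w, (∫⁻ θ in S, ∏ i, g θ (w i) ∂π) ^ (1 / 2 : ℝ) ∂(Measure.pi fun _ : Fin n => P) ≤
      ENNReal.ofReal ρ ^ n := by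
  have hρ1 : ENNReal.ofReal ρ ≠ 0 := by simpa using hρ0
  refine (lintegral_sqrt_mixture_pi_le P (π.restrict S) hg (ENNReal.ofReal ρ)
    (fun Q' hac hsf => ?_) n).trans ?_
  -- A reweighted measure may have infinite mass; then the right side is infinite because `ρ > 0`.
  -- Otherwise it is normalized, both sides scaling with the square root of the mass.
  · rcases eq_or_ne (Q' Set.univ) ∞ with htop | htop
    · rw [htop, ENNReal.top_rpow_of_pos (by norm_num), ENNReal.mul_top hρ1]
      exact le_top
    rcases eq_or_ne (Q' Set.univ) 0 with h0 | h0
    · simp [Measure.measure_univ_eq_zero.1 h0]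
    have hfin : IsFiniteMeasure Q' := ⟨htop.lt_top⟩
    have hne : NeZero Q' := ⟨fun h => h0 (by simp [h])⟩
    have hae : ∀ᵐ θ ∂Q', θ ∈ S := hac.ae_le (ae_restrict_mem hS)
    set c := Q' Set.univ
    have hprob : IsProbabilityMeasure (c⁻¹ • Q') := isProbabilityMeasureSMul
    have key := (lintegral_sqrt_mixture_le P (c⁻¹ • Q') hg hg1 (g₀ := g θ₀) hg.of_uncurry_left
      (hg1 θ₀) (Measure.ae_smul_measure (hae.mono haff) _) hτ).trans
      (ENNReal.ofReal_le_ofReal hρ)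
    calc ∫⁻ x, (∫⁻ θ, g θ x ∂Q') ^ (1 / 2 : ℝ) ∂P
        = ∫⁻ x, c ^ (1 / 2 : ℝ) * (∫⁻ θ, g θ x ∂(c⁻¹ • Q')) ^ (1 / 2 : ℝ) ∂P := by
          refine lintegral_congr fun x => ?_
          rw [← ENNReal.mul_rpow_of_nonneg _ _ (by norm_num), lintegral_smul_measure,
            smul_eq_mul, ← mul_assoc, ENNReal.mul_inv_cancel h0 htop, one_mul]
      _ = c ^ (1 / 2 : ℝ) * ∫⁻ x, (∫⁻ θ, g θ x ∂(c⁻¹ • Q')) ^ (1 / 2 : ℝ) ∂P :=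
          lintegral_const_mul _ (hg.lintegral_prod_left.pow_const _)
      _ ≤ _ := by
          rw [mul_comm]
          gcongr
  · calc _ ≤ ENNReal.ofReal ρ ^ n * 1 := by
          gcongr
          rw [Measure.restrict_apply_univ]
          exact (ENNReal.rpow_le_rpow prob_le_one (by norm_num)).trans (by simp)
      _ = _ := mul_one _

end MeasureTheory

/-! ### Splitting the posterior at a level of the integrated likelihood ratio -/

namespace ENNReal

/-- If `Z ≤ l`, then `U ≤ Z ≤ l` gives the first term. If `Z ≥ l`, then `Z⁻¹ ≤ l⁻¹`, and `V / Z`,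
being at most one, is at most its square root. The root is taken because mixtures over cells are
controlled through affinities. -/
theorem inv_mul_le_level {Z U V W l : ℝ≥0∞} (hUZ : U ≤ Z) (hVZ : V ≤ Z)
    (hU : U ≤ W + V) :
    Z⁻¹ * U ≤ l * Z⁻¹ + l⁻¹ * W + (l⁻¹) ^ (1 / 2 : ℝ) * V ^ (1 / 2 : ℝ) := by
  rcases eq_or_ne Z 0 with rfl | hZ0
  · simp [nonpos_iff_eq_zero.1 hUZ]
  rcases eq_or_ne Z ∞ with rfl | hZt
  · simp
  rcases le_total Z l with hZl | hZl
  · calc Z⁻¹ * U ≤ Z⁻¹ * l := by gcongr; exact hUZ.trans hZl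
      _ = l * Z⁻¹ := mul_comm _ _
      _ ≤ _ := by rw [add_assoc]; exact le_self_add
  · have hV1 : Z⁻¹ * V ≤ 1 := by
      rw [← ENNReal.inv_mul_cancel hZ0 hZt]
      gcongr
    have hV : Z⁻¹ * V ≤ (l⁻¹ * V) ^ (1 / 2 : ℝ) := by
      calc Z⁻¹ * V ≤ (Z⁻¹ * V) ^ (1 / 2 : ℝ) := by
            simpa using ENNReal.rpow_le_rpow_of_exponent_ge hV1 (show (1 / 2 : ℝ) ≤ 1 by norm_num)
        _ ≤ _ := by gcongr
    rw [ENNReal.mul_rpow_of_nonneg _ _ (by norm_num)] at hV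
    calc Z⁻¹ * U ≤ Z⁻¹ * (W + V) := by gcongr
      _ = Z⁻¹ * W + Z⁻¹ * V := mul_add _ _ _
      _ ≤ l⁻¹ * W + (l⁻¹) ^ (1 / 2 : ℝ) * V ^ (1 / 2 : ℝ) := by gcongr
      _ ≤ _ := by rw [add_assoc]; exact le_add_self

end ENNReal

namespace MeasureTheory

variable {X Θ : Type*} [MeasurableSpace X] [MeasurableSpace Θ]

theorem lintegral_lintegral_swap_of_measurable (P : Measure X) [SFinite P] (Q : Measure Θ)
    [SFinite Q] {F : Θ → X → ℝ≥0∞} (hF : Measurable (Function.uncurry F)) :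
    ∫⁻ x, ∫⁻ θ, F θ x ∂Q ∂P = ∫⁻ θ, ∫⁻ x, F θ x ∂P ∂Q :=
  (lintegral_lintegral_swap hF.aemeasurable).symm

/-- Fubini: each product of likelihood ratios has mean one under the truth. -/
theorem lintegral_setLIntegral_prod_eq (P : Measure X) [IsProbabilityMeasure P] (π : Measure Θ)
    [IsProbabilityMeasure π] {g : Θ → X → ℝ≥0∞} (hg : Measurable (Function.uncurry g))
    (hg1 : ∀ θ, ∫⁻ x, g θ x ∂P = 1) (S : Set Θ) (n : ℕ) :
    ∫⁻ w, ∫⁻ θ in S, ∏ i, g θ (w i) ∂π ∂(Measure.pi fun _ : Fin n => P) = π S := by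
  rw [lintegral_lintegral_swap_of_measurable _ _ (measurable_uncurry_prod hg n)]
  have : ∀ θ, ∫⁻ w, ∏ i, g θ (w i) ∂(Measure.pi fun _ : Fin n => P) = 1 := fun θ => by
    rw [lintegral_pi_prod P n hg.of_uncurry_left, hg1, one_pow]
  simp [this]

/-- The inverse of the integrated likelihood ratio has a small expectation if the prior puts enough
mass on densities whose chi-square divergence from the truth is small. -/
theorem lintegral_inv_lintegral_prod_le (P : Measure X) [IsProbabilityMeasure P] (π : Measure Θ)
    [IsProbabilityMeasure π] {g : Θ → X → ℝ≥0∞} (hg : Measurable (Function.uncurry g))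
    (h0 : ∀ θ x, g θ x ≠ 0) (htop : ∀ θ x, g θ x ≠ ∞) {A : Set Θ} (hA : MeasurableSet A)
    (hA0 : π A ≠ 0) {c : ℝ≥0∞} (hc : ∀ θ ∈ A, ∫⁻ x, (g θ x)⁻¹ ∂P ≤ c) (n : ℕ) :
    ∫⁻ w, (∫⁻ θ, ∏ i, g θ (w i) ∂π)⁻¹ ∂(Measure.pi fun _ : Fin n => P) ≤ (π A)⁻¹ * c ^ n := by
  have hm := measurable_uncurry_prod hg n
  have hminv : Measurable
      (Function.uncurry fun (θ : Θ) (w : Fin n → X) => (∏ i, g θ (w i))⁻¹) := hm.inv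
  have hAt : π A ≠ ∞ := measure_ne_top _ _
  have hp0 : ∀ (w : Fin n → X) θ, ∏ i, g θ (w i) ≠ 0 := fun w θ =>
    Finset.prod_ne_zero_iff.2 fun i _ => h0 θ (w i)
  have hpt : ∀ (w : Fin n → X) θ, ∏ i, g θ (w i) ≠ ∞ := fun w θ =>
    ENNReal.prod_ne_top fun i _ => htop θ (w i)
  have hpinv : ∀ (w : Fin n → X) θ, (∏ i, g θ (w i))⁻¹ = ∏ i, (g θ (w i))⁻¹ := fun w θ =>
    ENNReal.prod_inv_distrib fun i _ j _ _ => Or.inl (h0 θ (w i))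
  calc _ ≤ ∫⁻ w, (π A ^ 2)⁻¹ * ∫⁻ θ in A, (∏ i, g θ (w i))⁻¹ ∂π
        ∂(Measure.pi fun _ : Fin n => P) := by
        refine lintegral_mono fun w => ?_
        -- Restricting to `A` gives `1 / Z ≤ π(A)⁻² ∫_A 1 / ∏ g`, whose expectation factorizes over
        -- the observations.
        have h := sq_measure_le_lintegral_mul_lintegral_inv (π.restrict A)
          (hm.of_uncurry_right (y := w)) (hp0 w) (hpt w)
        rw [Measure.restrict_apply_univ] at h
        have h2 : π A ^ 2 ≤ (∫⁻ θ, ∏ i, g θ (w i) ∂π) * ∫⁻ θ in A, (∏ i, g θ (w i))⁻¹ ∂π :=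
          h.trans (mul_le_mul_left (setLIntegral_le_lintegral _ _) _)
        rw [mul_comm, ← div_eq_mul_inv, ENNReal.le_div_iff_mul_le (Or.inl (pow_ne_zero 2 hA0))
          (Or.inl (ENNReal.pow_ne_top hAt)), mul_comm, ← div_eq_mul_inv]
        exact ENNReal.div_le_of_le_mul' h2
    _ = (π A ^ 2)⁻¹ * ∫⁻ θ in A, ∫⁻ w, (∏ i, g θ (w i))⁻¹
          ∂(Measure.pi fun _ : Fin n => P) ∂π := by
        rw [lintegral_const_mul _ hminv.lintegral_prod_left,
          lintegral_lintegral_swap_of_measurable _ _ hminv]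
    _ ≤ (π A ^ 2)⁻¹ * ∫⁻ _ in A, c ^ n ∂π := by
        gcongr _ * ?_
        refine setLIntegral_mono' hA fun θ hθ => ?_
        simp_rw [hpinv]
        have hθm : Measurable fun x => (g θ x)⁻¹ := hg.of_uncurry_left.inv
        rw [lintegral_pi_prod P n hθm]
        gcongr
        exact hc θ hθ
    _ = (π A)⁻¹ * c ^ n := by
        rw [setLIntegral_const, pow_two, ENNReal.mul_inv (Or.inl hA0) (Or.inl hAt), mul_assoc,
          mul_comm (c ^ n), ← mul_assoc (π A)⁻¹ (π A), ENNReal.inv_mul_cancel hA0 hAt, one_mul]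

/-- A bound on the expected posterior mass of a set `B` that is covered by a set `W` of small prior
mass and by finitely many sets `S i`, at any level `l` for the integrated likelihood ratio. -/
theorem lintegral_posterior_ratio_le (P : Measure X) [IsProbabilityMeasure P] (π : Measure Θ)
    [IsProbabilityMeasure π] {g : Θ → X → ℝ≥0∞} (hg : Measurable (Function.uncurry g))
    (hg1 : ∀ θ, ∫⁻ x, g θ x ∂P = 1) {ι : Type*} (I : Finset ι) (S : ι → Set Θ) {B W : Set Θ}
    (hB : B ⊆ W ∪ ⋃ i ∈ I, S i) (l : ℝ≥0∞) {ρ : ℝ≥0∞} {n : ℕ}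
    (hS : ∀ i ∈ I, ∫⁻ w, (∫⁻ θ in S i, ∏ i, g θ (w i) ∂π) ^ (1 / 2 : ℝ)
      ∂(Measure.pi fun _ : Fin n => P) ≤ ρ) :
    ∫⁻ w, (∫⁻ θ, ∏ i, g θ (w i) ∂π)⁻¹ * ∫⁻ θ in B, ∏ i, g θ (w i) ∂π
        ∂(Measure.pi fun _ : Fin n => P) ≤
      l * (∫⁻ w, (∫⁻ θ, ∏ i, g θ (w i) ∂π)⁻¹ ∂(Measure.pi fun _ : Fin n => P)) +
        l⁻¹ * π W + (l⁻¹) ^ (1 / 2 : ℝ) * (I.card * ρ) := by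
  have hm := measurable_uncurry_prod hg n
  have hmS : ∀ S : Set Θ, Measurable fun w : Fin n → X => ∫⁻ θ in S, ∏ i, g θ (w i) ∂π :=
    fun S => hm.lintegral_prod_left
  have hmZ : Measurable fun w : Fin n → X => ∫⁻ θ, ∏ i, g θ (w i) ∂π := hm.lintegral_prod_left
  have hunion : ∀ (f : Θ → ℝ≥0∞), ∫⁻ θ in ⋃ i ∈ I, S i, f θ ∂π ≤ ∑ i ∈ I, ∫⁻ θ in S i, f θ ∂π := by
    intro f
    classical
    clear hB hS
    induction I using Finset.induction_on with
    | empty => simp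
    | insert i I hi ih =>
      rw [Finset.set_biUnion_insert, Finset.sum_insert hi]
      exact (lintegral_union_le _ _ _).trans (by gcongr)
  have hminv : Measurable fun w : Fin n → X => (∫⁻ θ, ∏ i, g θ (w i) ∂π)⁻¹ := hmZ.inv
  have hm1 : Measurable fun w : Fin n → X => l * (∫⁻ θ, ∏ i, g θ (w i) ∂π)⁻¹ :=
    hminv.const_mul _
  have hm2 : Measurable fun w : Fin n → X => l * (∫⁻ θ, ∏ i, g θ (w i) ∂π)⁻¹ +
      l⁻¹ * ∫⁻ θ in W, ∏ i, g θ (w i) ∂π := hm1.add ((hmS W).const_mul _)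
  calc _ ≤ ∫⁻ w, (l * (∫⁻ θ, ∏ i, g θ (w i) ∂π)⁻¹ + l⁻¹ * (∫⁻ θ in W, ∏ i, g θ (w i) ∂π) +
        (l⁻¹) ^ (1 / 2 : ℝ) * ∑ i ∈ I, (∫⁻ θ in S i, ∏ i, g θ (w i) ∂π) ^ (1 / 2 : ℝ))
        ∂(Measure.pi fun _ : Fin n => P) := by
        refine lintegral_mono fun w => ?_
        refine (ENNReal.inv_mul_le_level (l := l) (setLIntegral_le_lintegral _ _)
          (setLIntegral_le_lintegral (⋃ i ∈ I, S i) _)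
          ((lintegral_mono_set hB).trans (lintegral_union_le _ _ _))).trans ?_
        gcongr
        refine (ENNReal.rpow_le_rpow (hunion _) (by norm_num)).trans ?_
        exact ENNReal.rpow_half_sum_le _ _
    _ ≤ _ := by
        rw [lintegral_add_left hm2, lintegral_add_left hm1, lintegral_const_mul _ hminv,
          lintegral_const_mul _ (hmS W), lintegral_setLIntegral_prod_eq P π hg hg1,
          lintegral_const_mul _ (Finset.measurable_fun_sum _ fun i _ => (hmS _).pow_const _),
          lintegral_finsetSum _ fun i _ => (hmS _).pow_const _]
        gcongr
        exact (Finset.sum_le_sum hS).trans (by simp)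

end MeasureTheory

/-! ### Affinity and second moments in the one-parameter family -/

namespace GLM

variable (M : GLM)

theorem f_pos (y h : ℝ) : 0 < M.f y h := Real.exp_pos _

/-- The normalization at `h` determines the integral when `b h` is replaced by any constant `s`.
Every integral over the response below reduces to this one. -/
theorem lintegral_exp (h s : ℝ) :
    ∫⁻ y, ENNReal.ofReal (Real.exp (M.a h * y + s + M.c y)) ∂M.ν =
      ENNReal.ofReal (Real.exp (s - M.b h)) := by
  have hc := M.measurable_c
  have h1 : ∀ y, ENNReal.ofReal (Real.exp (M.a h * y + s + M.c y)) =
      ENNReal.ofReal (Real.exp (s - M.b h)) *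
        ENNReal.ofReal (Real.exp (M.a h * y + M.b h + M.c y)) := fun y => by
    rw [← ENNReal.ofReal_mul (Real.exp_pos _).le, ← Real.exp_add]
    congr 2
    ring
  simp_rw [h1]
  rw [lintegral_const_mul _ (by fun_prop), M.lintegral_density, mul_one]

theorem abs_b_sub_le {s : Set ℝ} (hs : Convex ℝ s) {L u v : ℝ}
    (hL : ∀ w ∈ s, |deriv M.b w| ≤ L) (hu : u ∈ s) (hv : v ∈ s) :
    |M.b v - M.b u| ≤ L * |v - u| :=
  hs.norm_image_sub_le_of_norm_deriv_le
    (fun w _ => (M.contDiff_b.differentiable (by norm_num)) w) hL hu hv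

theorem continuous_ψ : Continuous M.ψ :=
  (M.contDiff_b.continuous_deriv le_rfl).neg.div (M.contDiff_a.continuous_deriv le_rfl)
    M.deriv_a_ne_zero

/-- This is `b' = -a' ψ`; continuity on a compact interval makes the suprema in `D` genuine bounds.
-/
theorem abs_deriv_b_le {R w : ℝ} (hw : w ∈ Set.Icc (-R) R) :
    |deriv M.b w| ≤ (⨆ h : Set.Icc (-R) R, |deriv M.a h|) * ⨆ h : Set.Icc (-R) R, |M.ψ h| := by
  have hbdd : ∀ g : ℝ → ℝ, Continuous g →
      BddAbove (Set.range fun h : Set.Icc (-R) R => |g h|) := fun g hg => by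
    have := (isCompact_Icc (a := -R) (b := R)).bddAbove_image hg.abs.continuousOn
    rwa [Set.image_eq_range] at this
  have h1 : deriv M.b w = -(deriv M.a w * M.ψ w) := by
    have := M.deriv_a_ne_zero w
    simp only [ψ]
    field_simp
  rw [h1, abs_neg, abs_mul]
  exact mul_le_mul (le_ciSup (hbdd _ (M.contDiff_a.continuous_deriv le_rfl)) ⟨w, hw⟩)
    (le_ciSup (hbdd _ M.continuous_ψ) ⟨w, hw⟩) (abs_nonneg _)
    (Real.iSup_nonneg fun _ => abs_nonneg _)

theorem one_le_D {R : ℝ} (hR : 0 ≤ R) : 1 ≤ M.D R := by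
  have h1 : 0 ≤ ⨆ h : Set.Icc (-R) R, |deriv M.a h| := Real.iSup_nonneg fun _ => abs_nonneg _
  have h2 : 0 ≤ ⨆ h : Set.Icc (-R) R, |M.ψ h| := Real.iSup_nonneg fun _ => abs_nonneg _
  have := mul_nonneg (mul_nonneg hR h1) h2
  simp only [D]
  linarith

/-- The affinity of two conditional densities is at least `1 - L / 2 * |h - h'|` if `|b'| ≤ L`
between `h` and `h'`. -/
theorem affinity_response_ge {h h' L : ℝ} (hL : ∀ w ∈ Set.uIcc h h', |deriv M.b w| ≤ L) :
    ENNReal.ofReal (1 - L / 2 * |h - h'|) ≤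
      ∫⁻ y, ENNReal.ofReal (√(M.f y h) * √(M.f y h')) ∂M.ν := by
  -- The geometric mean of the two densities has natural parameter `(a h + a h') / 2`, which `a`
  -- attains at some `m` between `h` and `h'`.
  obtain ⟨m, hm, ham⟩ : (M.a h + M.a h') / 2 ∈ M.a '' Set.uIcc h h' := by
    apply intermediate_value_uIcc M.contDiff_a.continuous.continuousOn
    rw [Set.mem_uIcc]
    rcases le_total (M.a h) (M.a h') with hle | hle
    · left; constructor <;> linarith
    · right; constructor <;> linarith
  have hsq : ∀ y, √(M.f y h) * √(M.f y h') =
      Real.exp (M.a m * y + (M.b h + M.b h') / 2 + M.c y) := fun y => by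
    rw [f, f, ← Real.exp_half, ← Real.exp_half, ← Real.exp_add, ham]
    congr 1
    ring
  simp_rw [hsq]
  rw [M.lintegral_exp]
  apply ENNReal.ofReal_le_ofReal
  have h1 := (abs_le.1 (M.abs_b_sub_le (convex_uIcc h h') hL Set.left_mem_uIcc hm)).2
  have h2 := (abs_le.1 (M.abs_b_sub_le (convex_uIcc h h') hL Set.right_mem_uIcc hm)).2
  have h3 : |m - h| + |m - h'| = |h - h'| := by
    rcases Set.mem_uIcc.1 hm with ⟨h5, h6⟩ | ⟨h5, h6⟩
    · rw [abs_of_nonneg (by linarith), abs_of_nonpos (by linarith), abs_of_nonpos (by linarith)]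
      ring
    · rw [abs_of_nonpos (by linarith), abs_of_nonneg (by linarith), abs_of_nonneg (by linarith)]
      ring
  have h4 := Real.add_one_le_exp ((M.b h + M.b h') / 2 - M.b m)
  rw [← h3]
  nlinarith

end GLM

/-- A differentiable function with `m ≤ a'` on an interval around `h` attains all values within
`m * s` of `a h` within distance `s` of `h`. -/
theorem exists_eq_of_le_deriv {a : ℝ → ℝ} (ha : Differentiable ℝ a) {h s m v : ℝ} (hs : 0 ≤ s)
    (hm : ∀ w ∈ Set.Icc (h - s) (h + s), m ≤ deriv a w) (hv : |v - a h| ≤ m * s) :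
    ∃ h', |h' - h| ≤ s ∧ a h' = v := by
  have hmv : ∀ u ∈ Set.Icc (h - s) (h + s), ∀ w ∈ Set.Icc (h - s) (h + s), u ≤ w →
      m * (w - u) ≤ a w - a u :=
    (convex_Icc _ _).mul_sub_le_image_sub_of_le_deriv ha.continuous.continuousOn
      ha.differentiableOn (fun w hw => hm w (interior_subset hw))
  have h0 : h ∈ Set.Icc (h - s) (h + s) := ⟨by linarith, by linarith⟩
  have h1 := hmv h h0 (h + s) ⟨by linarith, le_rfl⟩ (by linarith)
  have h2 := hmv (h - s) ⟨le_rfl, by linarith⟩ h h0 (by linarith)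
  rw [abs_le] at hv
  obtain ⟨h', hh', rfl⟩ := intermediate_value_Icc (show h - s ≤ h + s by linarith)
    ha.continuous.continuousOn (show v ∈ Set.Icc (a (h - s)) (a (h + s)) from
      ⟨by nlinarith, by nlinarith⟩)
  exact ⟨h', abs_le.2 ⟨by linarith [hh'.1], by linarith [hh'.2]⟩, rfl⟩

/-- A continuous derivative without zeros has constant sign on the interval, so the increasing case
applies to `a` or to `-a`. -/
theorem exists_eq_of_le_abs_deriv {a : ℝ → ℝ} (ha : ContDiff ℝ 1 a) {h s m v : ℝ} (hs : 0 ≤ s)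
    (hm0 : 0 < m) (hm : ∀ w ∈ Set.Icc (h - s) (h + s), m ≤ |deriv a w|)
    (hv : |v - a h| ≤ m * s) : ∃ h', |h' - h| ≤ s ∧ a h' = v := by
  have hd : Differentiable ℝ a := ha.differentiable (by norm_num)
  have hc : ContinuousOn (deriv a) (Set.Icc (h - s) (h + s)) :=
    (ha.continuous_deriv le_rfl).continuousOn
  have hne : ∀ w ∈ Set.Icc (h - s) (h + s), deriv a w ≠ 0 := fun w hw h0 => by
    have := hm w hw
    rw [h0, abs_zero] at this
    linarith
  have hsign : (∀ w ∈ Set.Icc (h - s) (h + s), 0 < deriv a w) ∨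
      ∀ w ∈ Set.Icc (h - s) (h + s), deriv a w < 0 := by
    by_contra! hcon
    obtain ⟨⟨u, hu, hu0⟩, w, hw, hw0⟩ := hcon
    obtain ⟨z, hz, hz0⟩ := isPreconnected_Icc.intermediate_value hu hw hc ⟨hu0, hw0⟩
    exact hne z hz hz0
  rcases hsign with hpos | hneg
  · exact exists_eq_of_le_deriv hd hs (fun w hw => abs_of_pos (hpos w hw) ▸ hm w hw) hv
  · obtain ⟨h', h1, h2⟩ := exists_eq_of_le_deriv (a := fun w => -a w) (v := -v) hd.neg hs
      (fun w hw => by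
        rw [deriv.fun_neg]
        exact abs_of_neg (hneg w hw) ▸ hm w hw)
      (by rw [abs_sub_comm]; convert hv using 2; ring)
    exact ⟨h', h1, neg_injective h2⟩

namespace GLM

variable (M : GLM)

/-- The second moment of the density ratio of `h` and `h₀` is locally at most
`exp (L * |h - h₀|)`, uniformly for `h₀` in a compact interval. -/
theorem exists_lintegral_sq_div_le (H : ℝ) (hH : 0 ≤ H) : ∃ δ > 0, ∃ L > 0,
    ∀ h₀ h : ℝ, |h₀| ≤ H → |h - h₀| ≤ δ →
      ∫⁻ y, ENNReal.ofReal (M.f y h₀ * (M.f y h₀ / M.f y h)) ∂M.ν ≤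
        ENNReal.ofReal (Real.exp (L * |h - h₀|)) := by
  set I := Set.Icc (-(H + 1)) (H + 1) with hI
  have hIne : I.Nonempty := ⟨0, by constructor <;> linarith⟩
  have hIc : IsCompact I := isCompact_Icc
  have hca := (M.contDiff_a.continuous_deriv le_rfl).abs
  have hcb := (M.contDiff_b.continuous_deriv le_rfl).abs
  obtain ⟨um, -, hum⟩ := hIc.exists_isMinOn hIne hca.continuousOn
  obtain ⟨uM, -, huM⟩ := hIc.exists_isMaxOn hIne hca.continuousOn
  obtain ⟨ub, -, hub⟩ := hIc.exists_isMaxOn hIne hcb.continuousOn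
  set m := |deriv M.a um|
  set A := |deriv M.a uM|
  set B := |deriv M.b ub|
  have hm0 : 0 < m := abs_pos.2 (M.deriv_a_ne_zero _)
  have hA0 : 0 < A := abs_pos.2 (M.deriv_a_ne_zero _)
  have hB0 : 0 ≤ B := abs_nonneg _
  -- The radius keeps both `h` and the auxiliary point `h'`, at distance at most `(A / m) |h - h₀|`,
  -- within one of `h₀`. The slope adds the variation of `b` to both points; the extra `1` makes it
  -- positive.
  refine ⟨min 1 (m / A), lt_min one_pos (div_pos hm0 hA0), B * (1 + A / m) + 1, by positivity,
    fun h₀ h hh₀ hh => ?_⟩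
  have hh1 : |h - h₀| ≤ 1 := hh.trans (min_le_left _ _)
  have hh2 : A / m * |h - h₀| ≤ 1 := by
    have := hh.trans (min_le_right _ _)
    rw [le_div_iff₀ hA0] at this
    rw [div_mul_eq_mul_div, div_le_one hm0]
    linarith
  have hnear : ∀ u, |u - h₀| ≤ 1 → u ∈ I := fun u hu => by
    rw [abs_le] at hh₀ hu
    constructor <;> linarith
  have hh₀I : h₀ ∈ I := hnear h₀ (by simp)
  have hhI : h ∈ I := hnear h hh1
  have ha : |M.a h - M.a h₀| ≤ A * |h - h₀| :=
    (convex_Icc _ _).norm_image_sub_le_of_norm_deriv_le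
      (fun w _ => (M.contDiff_a.differentiable (by norm_num)) w) (fun w hw => huM hw) hh₀I hhI
  -- `f(·, h₀)² / f(·, h)` has natural parameter `2 a h₀ - a h`; it is attained near `h₀` because
  -- `|a'| ≥ m`.
  obtain ⟨h', hh', hah'⟩ : ∃ h', |h' - h₀| ≤ A / m * |h - h₀| ∧ M.a h' = 2 * M.a h₀ - M.a h := by
    refine exists_eq_of_le_abs_deriv M.contDiff_a (by positivity) hm0 (fun w hw => ?_) ?_
    · refine hum (hnear w (abs_le.2 ⟨?_, ?_⟩))
      · linarith [hw.1]
      · linarith [hw.2]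
    · have h1 : m * (A / m * |h - h₀|) = A * |h - h₀| := by field_simp
      rw [h1, abs_sub_comm]
      convert ha using 2
      ring
  have hh'I : h' ∈ I := hnear h' (hh'.trans hh2)
  have hsq : ∀ y, M.f y h₀ * (M.f y h₀ / M.f y h) =
      Real.exp (M.a h' * y + (2 * M.b h₀ - M.b h) + M.c y) := fun y => by
    rw [f, f, ← Real.exp_sub, ← Real.exp_add, hah']
    congr 1
    ring
  simp_rw [hsq]
  rw [M.lintegral_exp]
  apply ENNReal.ofReal_le_ofReal
  apply Real.exp_le_exp.2
  have h1 := (abs_le.1 (M.abs_b_sub_le (convex_Icc _ _) (fun w hw => hub hw) hh₀I hhI)).1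
  have h2 := (abs_le.1 (M.abs_b_sub_le (convex_Icc _ _) (fun w hw => hub hw) hh₀I hh'I)).1
  have h3 : B * |h' - h₀| ≤ B * (A / m * |h - h₀|) := by gcongr
  have h4 := abs_nonneg (h - h₀)
  simp only at h1 h2 h3 ⊢
  nlinarith

end GLM

/-! ### Joint densities, density ratios and the Hellinger affinity -/

namespace GLM

variable (M : GLM) {K : ℕ}

theorem density_pos (β : Fin K → ℝ) (z : (Fin K → ℝ) × ℝ) : 0 < M.density β z := M.f_pos _ _

theorem measurable_density_uncurry :
    Measurable fun p : (Fin K → ℝ) × ((Fin K → ℝ) × ℝ) => M.density p.1 p.2 := by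
  have ha := M.contDiff_a.continuous.measurable
  have hb := M.contDiff_b.continuous.measurable
  have hc := M.measurable_c
  have hl : Measurable fun p : (Fin K → ℝ) × ((Fin K → ℝ) × ℝ) => linPred p.2.1 p.1 := by
    unfold linPred
    fun_prop
  unfold density f
  fun_prop

theorem measurable_density (β : Fin K → ℝ) : Measurable (M.density β) := by
  have h : Measurable (Function.uncurry (M.density (K := K))) := M.measurable_density_uncurry
  exact h.of_uncurry_left

/-- The law of a single observation `(x, y)`. -/
def obsLaw (νx : Measure (Fin K → ℝ)) (β : Fin K → ℝ) : Measure ((Fin K → ℝ) × ℝ) :=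
  (νx.prod M.ν).withDensity fun z => ENNReal.ofReal (M.density β z)

variable (νx : Measure (Fin K → ℝ))

theorem lintegral_obsLaw (β : Fin K → ℝ) {F : (Fin K → ℝ) × ℝ → ℝ≥0∞} (hF : Measurable F) :
    ∫⁻ z, F z ∂(M.obsLaw νx β) = ∫⁻ z, ENNReal.ofReal (M.density β z) * F z ∂(νx.prod M.ν) := by
  rw [obsLaw, lintegral_withDensity_eq_lintegral_mul _ (M.measurable_density β).ennreal_ofReal hF]
  rfl

theorem lintegral_density_prod [IsProbabilityMeasure νx] (β : Fin K → ℝ) :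
    ∫⁻ z, ENNReal.ofReal (M.density β z) ∂(νx.prod M.ν) = 1 := by
  rw [lintegral_prod _ (M.measurable_density β).ennreal_ofReal.aemeasurable]
  simp [density, f, M.lintegral_density]

instance isProbabilityMeasure_obsLaw [IsProbabilityMeasure νx] (β : Fin K → ℝ) :
    IsProbabilityMeasure (M.obsLaw νx β) :=
  ⟨by rw [obsLaw, withDensity_apply _ MeasurableSet.univ, Measure.restrict_univ,
    M.lintegral_density_prod]⟩

/-- The density ratio of the coefficient vectors `β` and `β₀`. -/
def ratio (β₀ β : Fin K → ℝ) (z : (Fin K → ℝ) × ℝ) : ℝ≥0∞ :=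
  ENNReal.ofReal (M.density β z / M.density β₀ z)

theorem measurable_ratio_uncurry (β₀ : Fin K → ℝ) :
    Measurable (Function.uncurry (M.ratio β₀)) := by
  have h1 := M.measurable_density_uncurry (K := K)
  have h2 : Measurable fun p : (Fin K → ℝ) × ((Fin K → ℝ) × ℝ) => M.density β₀ p.2 :=
    (M.measurable_density β₀).comp measurable_snd
  exact (h1.div h2).ennreal_ofReal

theorem measurable_ratio (β₀ β : Fin K → ℝ) : Measurable (M.ratio β₀ β) :=
  (M.measurable_ratio_uncurry β₀).of_uncurry_left

theorem ratio_ne_zero (β₀ β : Fin K → ℝ) (z : (Fin K → ℝ) × ℝ) : M.ratio β₀ β z ≠ 0 := by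
  simpa [ratio] using div_pos (M.density_pos β z) (M.density_pos β₀ z)

theorem ratio_ne_top (β₀ β : Fin K → ℝ) (z : (Fin K → ℝ) × ℝ) : M.ratio β₀ β z ≠ ∞ :=
  ENNReal.ofReal_ne_top

theorem density_mul_ratio (β₀ β : Fin K → ℝ) (z : (Fin K → ℝ) × ℝ) :
    ENNReal.ofReal (M.density β₀ z) * M.ratio β₀ β z = ENNReal.ofReal (M.density β z) := by
  rw [ratio, ← ENNReal.ofReal_mul (M.density_pos β₀ z).le,
    mul_div_cancel₀ _ (M.density_pos β₀ z).ne']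

theorem lintegral_ratio [IsProbabilityMeasure νx] (β₀ β : Fin K → ℝ) :
    ∫⁻ z, M.ratio β₀ β z ∂(M.obsLaw νx β₀) = 1 := by
  rw [M.lintegral_obsLaw νx β₀ (M.measurable_ratio β₀ β)]
  simp_rw [density_mul_ratio]
  exact M.lintegral_density_prod νx β

/-- The Hellinger affinity. -/
def affinity (β β' : Fin K → ℝ) : ℝ≥0∞ :=
  ∫⁻ z, ENNReal.ofReal (√(M.density β z) * √(M.density β' z)) ∂(νx.prod M.ν)

theorem lintegral_sqrt_ratio_mul_ratio (β₀ β β' : Fin K → ℝ) :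
    ∫⁻ z, (M.ratio β₀ β z * M.ratio β₀ β' z) ^ (1 / 2 : ℝ) ∂(M.obsLaw νx β₀) =
      M.affinity νx β β' := by
  have hm : Measurable fun z => (M.ratio β₀ β z * M.ratio β₀ β' z) ^ (1 / 2 : ℝ) :=
    ((M.measurable_ratio β₀ β).mul (M.measurable_ratio β₀ β')).pow_const _
  rw [M.lintegral_obsLaw νx β₀ hm]
  refine lintegral_congr fun z => ?_
  have h0 := M.density_pos β₀ z
  have h1 := M.density_pos β z
  have h2 := M.density_pos β' z
  rw [ratio, ratio, ← ENNReal.ofReal_mul (by positivity), ENNReal.rpow_half_ofReal,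
    ← ENNReal.ofReal_mul h0.le, div_mul_div_comm, Real.sqrt_div (by positivity),
    Real.sqrt_mul_self h0.le, Real.sqrt_mul h1.le, mul_div_cancel₀ _ h0.ne']

theorem lintegral_sqrt_ratio (β₀ β : Fin K → ℝ) :
    ∫⁻ z, M.ratio β₀ β z ^ (1 / 2 : ℝ) ∂(M.obsLaw νx β₀) = M.affinity νx β β₀ := by
  rw [← M.lintegral_sqrt_ratio_mul_ratio νx β₀]
  refine lintegral_congr fun z => ?_
  have : M.ratio β₀ β₀ z = 1 := by
    rw [ratio, div_self (M.density_pos β₀ z).ne', ENNReal.ofReal_one]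
  rw [this, mul_one]

/-- The squared Hellinger distance is `2 - 2 · affinity`. -/
theorem affinity_toReal_of_lt_hellinger [IsProbabilityMeasure νx] {β β' : Fin K → ℝ} {c : ℝ}
    (hc : 0 ≤ c) (h : c < M.hellinger νx β β') : (M.affinity νx β β').toReal ≤ 1 - c ^ 2 / 2 := by
  have hint : ∀ β : Fin K → ℝ, Integrable (M.density β) (νx.prod M.ν) := fun β =>
    ⟨(M.measurable_density β).aestronglyMeasurable, by
      rw [hasFiniteIntegral_iff_ofReal (.of_forall fun z => (M.density_pos β z).le),
        M.lintegral_density_prod]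
      exact ENNReal.one_lt_top⟩
  have hone : ∀ β : Fin K → ℝ, ∫ z, M.density β z ∂(νx.prod M.ν) = 1 := fun β => by
    rw [integral_eq_lintegral_of_nonneg_ae (.of_forall fun z => (M.density_pos β z).le)
      (M.measurable_density β).aestronglyMeasurable, M.lintegral_density_prod,
      ENNReal.toReal_one]
  have hmeas : Measurable fun z => √(M.density β z) * √(M.density β' z) :=
    (M.measurable_density β).sqrt.mul (M.measurable_density β').sqrt
  have hsq : ∀ (β : Fin K → ℝ) z, √(M.density β z) ^ 2 = M.density β z := fun β z =>
    Real.sq_sqrt (M.density_pos β z).le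
  have hintm : Integrable (fun z => √(M.density β z) * √(M.density β' z)) (νx.prod M.ν) := by
    refine ((hint β).add (hint β')).mono' hmeas.aestronglyMeasurable (.of_forall fun z => ?_)
    rw [Real.norm_of_nonneg (by positivity)]
    change _ ≤ M.density β z + M.density β' z
    have h1 := hsq β z
    have h2 := hsq β' z
    nlinarith [sq_nonneg (√(M.density β z) - √(M.density β' z)), sq_nonneg (√(M.density β z)),
      sq_nonneg (√(M.density β' z))]
  have haff : (M.affinity νx β β').toReal =
      ∫ z, √(M.density β z) * √(M.density β' z) ∂(νx.prod M.ν) :=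
    (integral_eq_lintegral_of_nonneg_ae (.of_forall fun z => by positivity)
      hmeas.aestronglyMeasurable).symm
  have hexp : ∀ z, (√(M.density β z) - √(M.density β' z)) ^ 2 =
      M.density β z + M.density β' z - 2 * (√(M.density β z) * √(M.density β' z)) := fun z => by
    rw [sub_sq, hsq, hsq]
    ring
  rw [hellinger, Real.lt_sqrt hc] at h
  simp_rw [hexp] at h
  have hadd : Integrable (fun z => M.density β z + M.density β' z) (νx.prod M.ν) :=
    (hint β).add (hint β')
  rw [integral_sub hadd (hintm.const_mul 2), integral_add (hint β) (hint β'),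
    integral_const_mul, hone, hone, ← haff] at h
  linarith

/-- If the linear parameters of `β` and `β'` are almost surely bounded by `R` and within distance
`s` of each other, then the affinity is close to one. -/
theorem affinity_ge [IsProbabilityMeasure νx] {β β' : Fin K → ℝ} {R s : ℝ}
    (hβ : ∀ᵐ x ∂νx, |linPred x β| ≤ R)
    (hβ' : ∀ᵐ x ∂νx, |linPred x β'| ≤ R) (hs : ∀ᵐ x ∂νx, |linPred x β - linPred x β'| ≤ s) :
    ENNReal.ofReal (1 - ((⨆ h : Set.Icc (-R) R, |deriv M.a h|) *
      ⨆ h : Set.Icc (-R) R, |M.ψ h|) / 2 * s) ≤ M.affinity νx β β' := by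
  set L := (⨆ h : Set.Icc (-R) R, |deriv M.a h|) * ⨆ h : Set.Icc (-R) R, |M.ψ h|
  have hL : 0 ≤ L := mul_nonneg (Real.iSup_nonneg fun _ => abs_nonneg _)
    (Real.iSup_nonneg fun _ => abs_nonneg _)
  have hm : Measurable fun z : (Fin K → ℝ) × ℝ =>
      ENNReal.ofReal (√(M.density β z) * √(M.density β' z)) :=
    ((M.measurable_density β).sqrt.mul (M.measurable_density β').sqrt).ennreal_ofReal
  rw [affinity, lintegral_prod _ hm.aemeasurable]
  calc ENNReal.ofReal (1 - L / 2 * s) = ∫⁻ _, ENNReal.ofReal (1 - L / 2 * s) ∂νx := by simp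
    _ ≤ _ := by
      refine lintegral_mono_ae ?_
      filter_upwards [hβ, hβ', hs] with x h1 h2 h3
      refine le_trans ?_ (M.affinity_response_ge (h := linPred x β) (h' := linPred x β') (L := L)
        fun w hw => M.abs_deriv_b_le (Set.uIcc_subset_Icc (abs_le.1 h1) (abs_le.1 h2) hw))
      apply ENNReal.ofReal_le_ofReal
      gcongr

theorem lintegral_inv_ratio_le [IsProbabilityMeasure νx] {β₀ β : Fin K → ℝ} {H δ L s : ℝ}
    (hL : 0 ≤ L) (hchi : ∀ h₀ h : ℝ, |h₀| ≤ H → |h - h₀| ≤ δ →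
      ∫⁻ y, ENNReal.ofReal (M.f y h₀ * (M.f y h₀ / M.f y h)) ∂M.ν ≤
        ENNReal.ofReal (Real.exp (L * |h - h₀|)))
    (hβ₀ : ∀ᵐ x ∂νx, |linPred x β₀| ≤ H) (hsδ : s ≤ δ)
    (hs : ∀ᵐ x ∂νx, |linPred x β - linPred x β₀| ≤ s) :
    ∫⁻ z, (M.ratio β₀ β z)⁻¹ ∂(M.obsLaw νx β₀) ≤ ENNReal.ofReal (Real.exp (L * s)) := by
  have heq : ∀ z, ENNReal.ofReal (M.density β₀ z) * (M.ratio β₀ β z)⁻¹ =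
      ENNReal.ofReal (M.density β₀ z * (M.density β₀ z / M.density β z)) := fun z => by
    rw [ratio, ← ENNReal.ofReal_inv_of_pos (div_pos (M.density_pos β z) (M.density_pos β₀ z)),
      ← ENNReal.ofReal_mul (M.density_pos β₀ z).le, inv_div]
  have hm : Measurable fun z : (Fin K → ℝ) × ℝ =>
      ENNReal.ofReal (M.density β₀ z * (M.density β₀ z / M.density β z)) :=
    ((M.measurable_density β₀).mul
      ((M.measurable_density β₀).div (M.measurable_density β))).ennreal_ofReal
  have hminv : Measurable fun z => (M.ratio β₀ β z)⁻¹ := (M.measurable_ratio β₀ β).inv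
  rw [M.lintegral_obsLaw νx β₀ hminv]
  simp_rw [heq]
  rw [lintegral_prod _ hm.aemeasurable]
  calc _ ≤ ∫⁻ _, ENNReal.ofReal (Real.exp (L * s)) ∂νx := by
        refine lintegral_mono_ae ?_
        filter_upwards [hβ₀, hs] with x h1 h2
        refine (hchi (linPred x β₀) (linPred x β) h1 (h2.trans hsδ)).trans ?_
        gcongr
    _ = _ := by simp

end GLM

theorem abs_linPred_sub_le {K : ℕ} {x : Fin K → ℝ} (hx : ∀ j, |x j| ≤ 1) (β β' : Fin K → ℝ) :
    |linPred x β - linPred x β'| ≤ ∑ j, |β j - β' j| := by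
  rw [linPred, linPred, ← Finset.sum_sub_distrib]
  refine (Finset.abs_sum_le_sum_abs _ _).trans (Finset.sum_le_sum fun j _ => ?_)
  rw [← mul_sub, abs_mul]
  exact mul_le_of_le_one_left (abs_nonneg _) (hx j)

theorem abs_linPred_le {K : ℕ} {x : Fin K → ℝ} (hx : ∀ j, |x j| ≤ 1) (β : Fin K → ℝ) :
    |linPred x β| ≤ ∑ j, |β j| := by
  simpa [linPred] using abs_linPred_sub_le hx β 0

/-! ### The parameter space: measurability, sieve and cells -/

namespace Param

variable {K : ℕ}

theorem coef_of_notMem {θ : Param K} {j : Fin K} (h : j ∉ θ.1) : θ.coef j = 0 := dif_neg h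

theorem measurable_of_forall {α : Type*} [MeasurableSpace α] {F : Param K → α}
    (h : ∀ γ : Finset (Fin K), Measurable fun b : γ → ℝ => F ⟨γ, b⟩) : Measurable F :=
  fun _ hs => MeasurableSpace.measurableSet_iInf.2 fun γ => h γ hs

theorem measurable_coef : Measurable (Param.coef : Param K → Fin K → ℝ) := by
  refine measurable_of_forall fun γ => measurable_pi_lambda _ fun j => ?_
  by_cases h : j ∈ γ
  · simpa [coef, h] using measurable_pi_apply (⟨j, h⟩ : γ)
  · simp [coef, h]

theorem measurableSet_fst (s : Set (Finset (Fin K))) :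
    MeasurableSet {θ : Param K | θ.1 ∈ s} := by
  have : Measurable fun θ : Param K => θ.1 ∈ s := measurable_of_forall fun γ =>
    measurable_const (a := γ ∈ s)
  exact measurableSet_setOfPred.2 this

theorem measurableSet_modelEvent (γ : Finset (Fin K)) :
    MeasurableSet (modelEvent γ : Set (Param K)) :=
  measurableSet_fst {γ}

end Param

namespace Param

variable {K : ℕ}

/-- The parameters with a model of size at most `r` and coefficients bounded by `C`. -/
def sieve (K : ℕ) (r C : ℝ) : Set (Param K) :=
  {θ | (θ.1.card : ℝ) ≤ r ∧ ∀ j, |θ.coef j| ≤ C}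

/-- The cell of the parameter space with a given model, coefficients bounded by `C`, and given
integer parts of the coefficients in units of `δ`. -/
def cell (C δ : ℝ) (i : Σ _ : Finset (Fin K), Fin K → ℤ) : Set (Param K) :=
  {θ | θ.1 = i.1 ∧ ∀ j, |θ.coef j| ≤ C ∧ ⌊θ.coef j / δ⌋ = i.2 j}

/-- The indices of the cells that meet the sieve, for models of size at most `k` and integer parts
between `-m` and `m`. -/
def cellIndex (K k : ℕ) (m : ℤ) : Finset (Σ _ : Finset (Fin K), Fin K → ℤ) :=
  (Finset.univ.filter fun γ : Finset (Fin K) => γ.card ≤ k).sigma fun γ =>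
    Fintype.piFinset fun j => if j ∈ γ then Finset.Icc (-m) m else {0}

theorem measurableSet_cell (C δ : ℝ) (i : Σ _ : Finset (Fin K), Fin K → ℤ) :
    MeasurableSet (cell C δ i) := by
  have hcoef : ∀ j, Measurable fun θ : Param K => θ.coef j := fun j =>
    (measurable_pi_apply j).comp measurable_coef
  refine (measurableSet_fst {i.1}).inter ?_
  change MeasurableSet {θ : Param K | ∀ j, |θ.coef j| ≤ C ∧ ⌊θ.coef j / δ⌋ = i.2 j}
  simp only [Set.ofPred_forall]
  refine MeasurableSet.iInter fun j => ?_
  refine (measurableSet_le (hcoef j).abs measurable_const).inter ?_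
  exact (Int.measurable_floor.comp ((hcoef j).div_const δ)) (measurableSet_singleton (i.2 j))

theorem sieve_subset_iUnion_cell {r C δ : ℝ} (hδ : 0 < δ) :
    sieve K r C ⊆ ⋃ i ∈ cellIndex K ⌊r⌋₊ ⌈C / δ⌉, cell C δ i := by
  rintro θ ⟨hcard, hC⟩
  simp only [Set.mem_iUnion]
  refine ⟨⟨θ.1, fun j => ⌊θ.coef j / δ⌋⟩, ?_, rfl, fun j => ⟨hC j, rfl⟩⟩
  simp only [cellIndex, Finset.mem_sigma, Finset.mem_filter, Finset.mem_univ, true_and,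
    Fintype.mem_piFinset]
  refine ⟨Nat.le_floor hcard, fun j => ?_⟩
  split_ifs with hj
  · obtain ⟨h1, h2⟩ := abs_le.1 (hC j)
    rw [Finset.mem_Icc, Int.le_floor, Int.cast_neg]
    constructor
    · refine (neg_le_neg (Int.le_ceil (C / δ))).trans ?_
      rw [← neg_div]
      gcongr
    · refine (Int.cast_le (R := ℝ)).1 ((Int.floor_le _).trans (le_trans ?_ (Int.le_ceil _)))
      gcongr
  · simp [coef_of_notMem hj]

/-- Each model of size at most `k` has at most `(2m+1)^k` coefficient patterns. Weighting models by
`K^{-|γ|}` costs at most `K^k`, and these weights sum to `(1 + 1/K)^K ≤ e`. -/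
theorem card_cellIndex_le (hK : 1 ≤ K) (k : ℕ) {m : ℤ} (hm : 0 ≤ m) :
    ((cellIndex K k m).card : ℝ) ≤ Real.exp 1 * (K * (2 * m + 1)) ^ k := by
  have hK0 : (0 : ℝ) < K := by exact_mod_cast hK
  have hK1 : (1 : ℝ) ≤ K := by exact_mod_cast hK
  have hm0 : (0 : ℝ) ≤ m := by exact_mod_cast hm
  have hcard : ∀ γ : Finset (Fin K), ((Fintype.piFinset fun j =>
      if j ∈ γ then Finset.Icc (-m) m else {0}).card : ℝ) = (2 * m + 1) ^ γ.card := fun γ => by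
    have h1 : ∀ j, (if j ∈ γ then Finset.Icc (-m) m else {0} : Finset ℤ).card =
        if j ∈ γ then (2 * m + 1).toNat else 1 := fun j => by
      split_ifs
      · rw [Int.card_Icc]
        congr 1
        ring
      · simp
    have h2 : (((2 * m + 1).toNat : ℕ) : ℝ) = 2 * m + 1 := by
      rw [← Int.cast_natCast, Int.toNat_of_nonneg (by omega)]
      push_cast
      rfl
    rw [Fintype.card_piFinset]
    simp_rw [h1]
    rw [Finset.prod_ite_mem, Finset.univ_inter, Finset.prod_const, Nat.cast_pow, h2]
  have hsum : ∑ γ : Finset (Fin K), ((K : ℝ)⁻¹) ^ γ.card ≤ Real.exp 1 := by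
    have h := Fintype.sum_pow_mul_eq_add_pow (Fin K) (K : ℝ)⁻¹ 1
    simp only [one_pow, mul_one, Fintype.card_fin] at h
    rw [h]
    calc ((K : ℝ)⁻¹ + 1) ^ K ≤ Real.exp ((K : ℝ)⁻¹) ^ K := by
          gcongr
          exact Real.add_one_le_exp _
      _ = Real.exp 1 := by rw [← Real.exp_nat_mul, mul_inv_cancel₀ hK0.ne']
  rw [cellIndex, Finset.card_sigma, Nat.cast_sum]
  simp_rw [hcard]
  calc ∑ γ ∈ Finset.univ.filter (fun γ : Finset (Fin K) => γ.card ≤ k), (2 * (m : ℝ) + 1) ^ γ.card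
      ≤ ∑ γ ∈ Finset.univ.filter (fun γ : Finset (Fin K) => γ.card ≤ k),
          (K * (2 * (m : ℝ) + 1)) ^ k * ((K : ℝ)⁻¹) ^ γ.card := by
        refine Finset.sum_le_sum fun γ hγ => ?_
        have hγk := (Finset.mem_filter.1 hγ).2
        have h1 : (1 : ℝ) ≤ K ^ k * ((K : ℝ)⁻¹) ^ γ.card := by
          rw [inv_pow, ← div_eq_mul_inv, one_le_div (by positivity)]
          exact pow_le_pow_right₀ hK1 hγk
        have h2 : (2 * (m : ℝ) + 1) ^ γ.card ≤ (2 * m + 1) ^ k :=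
          pow_le_pow_right₀ (by linarith) hγk
        calc (2 * (m : ℝ) + 1) ^ γ.card ≤ (2 * m + 1) ^ k * (K ^ k * ((K : ℝ)⁻¹) ^ γ.card) :=
              h2.trans (le_mul_of_one_le_right (by positivity) h1)
          _ = _ := by rw [mul_pow]; ring
    _ ≤ ∑ γ : Finset (Fin K), (K * (2 * (m : ℝ) + 1)) ^ k * ((K : ℝ)⁻¹) ^ γ.card :=
        Finset.sum_le_sum_of_subset_of_nonneg (Finset.filter_subset _ _)
          fun γ _ _ => by positivity
    _ ≤ _ := by
        rw [← Finset.mul_sum, mul_comm]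
        gcongr

theorem card_cellIndex_le_exp (hK : 1 ≤ K) {r q : ℝ} (hr : 0 ≤ r) (hq : 1 ≤ q) :
    ((cellIndex K ⌊r⌋₊ ⌈q⌉).card : ℝ) ≤
      Real.exp (1 + r * (Real.log K + Real.log 5 + Real.log q)) := by
  have hK1 : (1 : ℝ) ≤ K := by exact_mod_cast hK
  have hlog : 0 ≤ Real.log K + Real.log 5 + Real.log q := by
    have := Real.log_nonneg hK1
    have := Real.log_nonneg hq
    have := Real.log_nonneg (show (1 : ℝ) ≤ 5 by norm_num)
    linarith
  have hceil : (⌈q⌉ : ℝ) < q + 1 := Int.ceil_lt_add_one q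
  have hceil0 : (0 : ℝ) ≤ (⌈q⌉ : ℝ) := by exact_mod_cast Int.ceil_nonneg (by linarith)
  calc ((cellIndex K ⌊r⌋₊ ⌈q⌉).card : ℝ)
      ≤ Real.exp 1 * (K * (2 * (⌈q⌉ : ℝ) + 1)) ^ ⌊r⌋₊ :=
        card_cellIndex_le hK _ (Int.ceil_nonneg (by linarith))
    -- `2⌈q⌉ + 1 ≤ 2q + 3 ≤ 5q`, since `q ≥ 1`.
    _ ≤ Real.exp 1 * (K * (5 * q)) ^ ⌊r⌋₊ := by
        gcongr
        linarith
    _ = Real.exp (1 + ⌊r⌋₊ * (Real.log K + Real.log 5 + Real.log q)) := by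
        rw [Real.exp_add, Real.exp_nat_mul, add_assoc, Real.exp_add, Real.exp_add,
          Real.exp_log (by linarith), Real.exp_log (by norm_num), Real.exp_log (by linarith)]
    _ ≤ _ := by
        gcongr
        exact Nat.floor_le hr

theorem sum_le_card_mul {θ θ' : Param K} (h : θ.1 = θ'.1) {g : ℝ → ℝ → ℝ} (hg : g 0 0 = 0) {c : ℝ}
    (hc : ∀ j, g (θ.coef j) (θ'.coef j) ≤ c) :
    ∑ j, g (θ.coef j) (θ'.coef j) ≤ θ.1.card * c := by
  have h1 : ∑ j, g (θ.coef j) (θ'.coef j) = ∑ j ∈ θ.1, g (θ.coef j) (θ'.coef j) := by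
    refine (Finset.sum_subset (Finset.subset_univ _) fun j _ hj => ?_).symm
    rw [coef_of_notMem hj, coef_of_notMem (h ▸ hj), hg]
  rw [h1, ← nsmul_eq_mul]
  exact Finset.sum_le_card_nsmul _ _ _ fun j _ => hc j

end Param

/-! ### The nonasymptotic bound on the expected posterior mass -/

namespace GLM

variable (M : GLM) {K : ℕ} (νx : Measure (Fin K → ℝ))

/-- Two members of a cell share a model of size at most `r`, so their linear parameters are bounded
by `r C` and differ by at most `r` mesh widths. The mesh is chosen so that the affinity loss is
`(ε²/2) (D - 1) / D`. -/
theorem affinity_ge_of_mem_cell [IsProbabilityMeasure νx]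
    (hx : ∀ᵐ x ∂νx, ∀ j, |x j| ≤ 1) {r C ε : ℝ} (hr : 0 < r)
    (hC : 0 < C) (hε : 0 < ε) {i : Σ _ : Finset (Fin K), Fin K → ℤ} (hi : (i.1.card : ℝ) ≤ r)
    {θ θ' : Param K} (hθ : θ ∈ Param.cell C (ε ^ 2 * C / M.D (r * C)) i)
    (hθ' : θ' ∈ Param.cell C (ε ^ 2 * C / M.D (r * C)) i) :
    ENNReal.ofReal (1 - ε ^ 2 / 2) ≤ M.affinity νx θ.coef θ'.coef := by
  have hD := M.one_le_D (mul_pos hr hC).le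
  set δ := ε ^ 2 * C / M.D (r * C) with hδ
  have hδ0 : 0 < δ := div_pos (by positivity) (by linarith)
  have hbound : ∀ θ ∈ Param.cell C δ i, ∀ᵐ x ∂νx, |linPred x θ.coef| ≤ r * C := by
    intro θ hθ
    filter_upwards [hx] with x hx
    refine (abs_linPred_le hx _).trans ((Param.sum_le_card_mul (θ := θ) (θ' := θ) rfl
      (g := fun u _ => |u|) abs_zero fun j => (hθ.2 j).1).trans ?_)
    rw [hθ.1]
    gcongr
  have hdiff : ∀ᵐ x ∂νx, |linPred x θ.coef - linPred x θ'.coef| ≤ r * δ := by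
    filter_upwards [hx] with x hx
    refine (abs_linPred_sub_le hx _ _).trans ((Param.sum_le_card_mul (θ := θ) (θ' := θ')
      (hθ.1.trans hθ'.1.symm) (g := fun u v => |u - v|) (by simp) (c := δ) fun j => ?_).trans ?_)
    · have := Int.abs_sub_lt_one_of_floor_eq_floor ((hθ.2 j).2.trans (hθ'.2 j).2.symm)
      rw [← sub_div, abs_div, abs_of_pos hδ0, div_lt_one hδ0] at this
      exact this.le
    · rw [hθ.1]
      gcongr
  refine le_trans (ENNReal.ofReal_le_ofReal ?_)
    (M.affinity_ge νx (hbound θ hθ) (hbound θ' hθ') hdiff)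
  set A := ⨆ h : Set.Icc (-(r * C)) (r * C), |deriv M.a h|
  set B := ⨆ h : Set.Icc (-(r * C)) (r * C), |M.ψ h|
  have hDeq : M.D (r * C) = 1 + r * C * A * B := rfl
  have h1 : A * B / 2 * (r * δ) = ε ^ 2 / 2 * ((M.D (r * C) - 1) / M.D (r * C)) := by
    rw [hδ, hDeq]
    ring
  have h2 : (M.D (r * C) - 1) / M.D (r * C) ≤ 1 := by
    rw [div_le_one (by linarith)]
    linarith
  have h3 := mul_le_mul_of_nonneg_left h2 (show 0 ≤ ε ^ 2 / 2 by positivity)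
  linarith

theorem measurable_ratio_coef_uncurry (β₀ : Fin K → ℝ) :
    Measurable (Function.uncurry fun θ : Param K => M.ratio β₀ θ.coef) := by
  have h : Measurable fun p : Param K × ((Fin K → ℝ) × ℝ) => (p.1.coef, p.2) :=
    (Param.measurable_coef.comp measurable_fst).prodMk measurable_snd
  have heq : (Function.uncurry fun θ : Param K => M.ratio β₀ θ.coef) =
      Function.uncurry (M.ratio β₀) ∘ fun p : Param K × ((Fin K → ℝ) × ℝ) => (p.1.coef, p.2) := by
    funext p
    rfl
  rw [heq]
  exact (M.measurable_ratio_uncurry β₀).comp h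

theorem likelihood_eq (β₀ : Fin K → ℝ) {n : ℕ} (w : Fin n → (Fin K → ℝ) × ℝ) (θ : Param K) :
    M.likelihood w θ =
      (∏ i, ENNReal.ofReal (M.density β₀ (w i))) * ∏ i, M.ratio β₀ θ.coef (w i) := by
  rw [← Finset.prod_mul_distrib]
  simp_rw [density_mul_ratio]
  rfl

/-- The likelihood of any reference vector `β₀` is positive and finite, and cancels between
numerator and normalization. -/
theorem posterior_apply (prior : Measure (Param K)) [IsProbabilityMeasure prior] (β₀ : Fin K → ℝ)
    {n : ℕ} (w : Fin n → (Fin K → ℝ) × ℝ) (B : Set (Param K)) :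
    M.posterior prior w B = (∫⁻ θ, ∏ i, M.ratio β₀ θ.coef (w i) ∂prior)⁻¹ *
      ∫⁻ θ in B, ∏ i, M.ratio β₀ θ.coef (w i) ∂prior := by
  have hm : Measurable fun θ : Param K => ∏ i, M.ratio β₀ θ.coef (w i) :=
    (measurable_uncurry_prod (M.measurable_ratio_coef_uncurry β₀) n).of_uncurry_right
  have h0 : ∏ i, ENNReal.ofReal (M.density β₀ (w i)) ≠ 0 :=
    Finset.prod_ne_zero_iff.2 fun i _ => by simpa using M.density_pos β₀ (w i)
  have htop : ∏ i, ENNReal.ofReal (M.density β₀ (w i)) ≠ ∞ :=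
    ENNReal.prod_ne_top fun i _ => ENNReal.ofReal_ne_top
  rw [posterior, Measure.smul_apply, smul_eq_mul, withDensity_apply']
  simp_rw [M.likelihood_eq β₀]
  rw [lintegral_const_mul _ hm, lintegral_const_mul _ hm,
    ENNReal.mul_inv (Or.inl h0) (Or.inl htop), mul_mul_mul_comm, ENNReal.inv_mul_cancel h0 htop,
    one_mul]

/-- A nonasymptotic bound on the expected posterior mass outside a Hellinger ball. -/
theorem lintegral_posterior_hellinger_le [IsProbabilityMeasure νx]
    (hx : ∀ᵐ x ∂νx, ∀ j, |x j| ≤ 1) (β₀ : Fin K → ℝ)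
    (prior : Measure (Param K)) [IsProbabilityMeasure prior] {r C ε t : ℝ} (hr : 0 < r) (hC : 0 < C)
    (hε : 0 < ε) {n : ℕ} (ht : t = n * ε ^ 2)
    (hcard : ((Param.cellIndex K ⌊r⌋₊ ⌈M.D (r * C) / ε ^ 2⌉).card : ℝ) ≤ Real.exp t)
    (hsieve : prior (Param.sieve K r C)ᶜ ≤ ENNReal.ofReal (Real.exp (-3 * t)))
    {A : Set (Param K)} (hA : MeasurableSet A)
    (hprior : ENNReal.ofReal (Real.exp (-t / 4)) ≤ prior A)
    (hchi : ∀ θ ∈ A, ∫⁻ z, (M.ratio β₀ θ.coef z)⁻¹ ∂(M.obsLaw νx β₀) ≤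
      ENNReal.ofReal (Real.exp (ε ^ 2 / 4))) :
    ∫⁻ w, M.posterior prior w {θ | 4 * ε < M.hellinger νx θ.coef β₀} ∂(M.dataLaw νx β₀ n) ≤
      ENNReal.ofReal (Real.exp (-t / 2)) + ENNReal.ofReal (Real.exp (-2 * t)) +
        ENNReal.ofReal (Real.exp (-2 * t)) := by
  classical
  have hexp : ∀ u v : ℝ, ENNReal.ofReal (Real.exp u) * ENNReal.ofReal (Real.exp v) =
      ENNReal.ofReal (Real.exp (u + v)) := fun u v => by
    rw [← ENNReal.ofReal_mul (Real.exp_pos _).le, Real.exp_add]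
  have hexpn : ∀ u : ℝ, ENNReal.ofReal (Real.exp u) ^ n = ENNReal.ofReal (Real.exp (n * u)) :=
    fun u => by rw [← ENNReal.ofReal_pow (Real.exp_pos _).le, Real.exp_nat_mul]
  have hexpinv : ∀ u : ℝ, (ENNReal.ofReal (Real.exp u))⁻¹ = ENNReal.ofReal (Real.exp (-u)) :=
    fun u => by rw [← ENNReal.ofReal_inv_of_pos (Real.exp_pos _), Real.exp_neg]
  have hD := M.one_le_D (mul_pos hr hC).le
  set δ := ε ^ 2 * C / M.D (r * C) with hδ
  have hδ0 : 0 < δ := div_pos (by positivity) (by linarith)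
  have hCδ : C / δ = M.D (r * C) / ε ^ 2 := by
    rw [hδ]
    field_simp
  set bad : Set (Param K) := {θ | 4 * ε < M.hellinger νx θ.coef β₀} with hbad
  set I := Param.cellIndex K ⌊r⌋₊ ⌈M.D (r * C) / ε ^ 2⌉ with hI
  -- Only cells meeting the bad set are kept; whole cells are measurable, so measurability of the
  -- bad set is not needed.
  set J := I.filter fun i => ∃ θ ∈ Param.cell C δ i, θ ∈ bad with hJ
  have hg := M.measurable_ratio_coef_uncurry β₀
  have hg1 : ∀ θ : Param K, ∫⁻ z, M.ratio β₀ θ.coef z ∂(M.obsLaw νx β₀) = 1 := fun θ =>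
    M.lintegral_ratio νx β₀ θ.coef
  have hcover : bad ⊆ (Param.sieve K r C)ᶜ ∪ ⋃ i ∈ J, Param.cell C δ i := by
    intro θ hθ
    by_cases hs : θ ∈ Param.sieve K r C
    · right
      have := Param.sieve_subset_iUnion_cell hδ0 hs
      rw [hCδ] at this
      simp only [Set.mem_iUnion] at this ⊢
      obtain ⟨i, hi, hθi⟩ := this
      exact ⟨i, Finset.mem_filter.2 ⟨hi, θ, hθi, hθ⟩, hθi⟩
    · exact Or.inl hs
  have hcell : ∀ i ∈ J, ∫⁻ w, (∫⁻ θ in Param.cell C δ i, ∏ k, M.ratio β₀ θ.coef (w k) ∂prior) ^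
      (1 / 2 : ℝ) ∂(Measure.pi fun _ : Fin n => M.obsLaw νx β₀) ≤
      ENNReal.ofReal (Real.exp (-(7 / 2) * t)) := by
    intro i hi
    obtain ⟨hiI, θ₀, hθ₀, hθ₀bad⟩ := Finset.mem_filter.1 hi
    have hir : (i.1.card : ℝ) ≤ r := by
      have h := (Finset.mem_sigma.1 hiI).1
      exact (Nat.le_floor_iff hr.le).1 (Finset.mem_filter.1 h).2
    -- With these values `(1 + τ) / 2 + κ = 1 - 4ε² + ε²/2 = 1 - (7/2) ε²`, at most `ρ`.
    refine (lintegral_sqrt_setLIntegral_prod_le (M.obsLaw νx β₀) prior hg hg1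
      (Param.measurableSet_cell C δ i) (θ₀ := θ₀) (κ := ε ^ 2 / 2) (τ := 1 - (4 * ε) ^ 2 / 2)
      (fun θ hθ => ?_) ?_ (ρ := Real.exp (-(7 / 2) * ε ^ 2)) (Real.exp_pos _) ?_ n).trans ?_
    · rw [M.lintegral_sqrt_ratio_mul_ratio]
      exact M.affinity_ge_of_mem_cell νx hx hr hC hε hir hθ₀ hθ
    · rw [M.lintegral_sqrt_ratio]
      exact M.affinity_toReal_of_lt_hellinger νx (by positivity) hθ₀bad
    · have := Real.add_one_le_exp (-(7 / 2) * ε ^ 2)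
      linarith
    · rw [hexpn, ht]
      apply le_of_eq
      congr 2
      ring
  have hpost := lintegral_posterior_ratio_le (M.obsLaw νx β₀) prior hg hg1 J
    (fun i => Param.cell C δ i) hcover (ENNReal.ofReal (Real.exp (-t))) hcell
  have hA0 : prior A ≠ 0 := fun h => by
    rw [h, nonpos_iff_eq_zero, ENNReal.ofReal_eq_zero] at hprior
    exact absurd hprior (not_le.2 (Real.exp_pos _))
  have hinv := lintegral_inv_lintegral_prod_le (M.obsLaw νx β₀) prior hg
    (fun θ z => M.ratio_ne_zero β₀ θ.coef z) (fun θ z => M.ratio_ne_top β₀ θ.coef z) hA hA0 hchi n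
  have hinv2 : (prior A)⁻¹ * ENNReal.ofReal (Real.exp (ε ^ 2 / 4)) ^ n ≤
      ENNReal.ofReal (Real.exp (t / 2)) := by
    calc _ ≤ (ENNReal.ofReal (Real.exp (-t / 4)))⁻¹ * ENNReal.ofReal (Real.exp (ε ^ 2 / 4)) ^ n := by
          gcongr
      _ = _ := by
          rw [hexpn, hexpinv, hexp, ht]
          congr 2
          ring
  have hJcard : (J.card : ℝ≥0∞) ≤ ENNReal.ofReal (Real.exp t) := by
    rw [← ENNReal.ofReal_natCast]
    apply ENNReal.ofReal_le_ofReal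
    refine le_trans ?_ hcard
    exact_mod_cast Finset.card_filter_le _ _
  simp_rw [M.posterior_apply prior β₀]
  refine hpost.trans ?_
  rw [hexpinv, ENNReal.rpow_half_ofReal, neg_neg, ← Real.exp_half]
  gcongr
  · calc _ ≤ ENNReal.ofReal (Real.exp (-t)) * ENNReal.ofReal (Real.exp (t / 2)) := by
          gcongr
          exact hinv.trans hinv2
      _ = _ := by
          rw [hexp]
          congr 2
          ring
  · calc _ ≤ ENNReal.ofReal (Real.exp t) * ENNReal.ofReal (Real.exp (-3 * t)) := by gcongr
      _ = _ := by
          rw [hexp]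
          congr 2
          ring
  · calc _ ≤ ENNReal.ofReal (Real.exp (t / 2)) *
          (ENNReal.ofReal (Real.exp t) * ENNReal.ofReal (Real.exp (-(7 / 2) * t))) := by gcongr
      _ = _ := by
          rw [hexp, hexp]
          congr 2
          ring

end GLM

/-! ### Prior mass outside the sieve -/

namespace Param

variable {K : ℕ}

theorem measurableSet_neighborhood (γ : Finset (Fin K)) (β : Fin K → ℝ) (s : ℝ) :
    MeasurableSet {θ : Param K | ∀ j ∈ γ, |θ.coef j - β j| < s} := by
  simp only [Set.ofPred_forall]
  refine MeasurableSet.iInter fun j => MeasurableSet.iInter fun _ => ?_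
  exact measurableSet_lt (((measurable_pi_apply j).comp measurable_coef).sub_const _).abs
    measurable_const

theorem sum_measure_modelEvent_le_one (π : Measure (Param K)) [IsProbabilityMeasure π]
    (s : Finset (Finset (Fin K))) : ∑ γ ∈ s, π (modelEvent γ) ≤ 1 := by
  have h := sum_measure_preimage_singleton (μ := π) s (f := fun θ : Param K => θ.1)
    fun γ _ => measurableSet_modelEvent γ
  exact (le_of_eq h).trans prob_le_one

/-- Given the model, a union bound over its at most `r` coefficients costs a factor `r`. Averaging
over models with their prior weights adds no further factor, so the number of models does not enter.
-/
theorem measure_compl_sieve_le (π : Measure (Param K)) [IsProbabilityMeasure π] {r C : ℝ}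
    (hC : 0 ≤ C) {e : ℝ≥0∞} (h1 : π {θ | r < (θ.1.card : ℝ)} ≤ e)
    (h2 : ∀ γ : Finset (Fin K), (γ.card : ℝ) ≤ r → ∀ j ∈ γ,
      ProbabilityTheory.cond π (modelEvent γ) {θ | C < |θ.coef j|} ≤ e) :
    π (sieve K r C)ᶜ ≤ (1 + ENNReal.ofReal r) * e := by
  classical
  set F : Finset (Finset (Fin K)) := Finset.univ.filter fun γ => (γ.card : ℝ) ≤ r
  have hsub : (sieve K r C)ᶜ ⊆ {θ | r < (θ.1.card : ℝ)} ∪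
      ⋃ γ ∈ F, ⋃ j ∈ γ, (modelEvent γ ∩ {θ | C < |θ.coef j|}) := by
    intro θ hθ
    by_cases hr : (θ.1.card : ℝ) ≤ r
    · right
      obtain ⟨j, hj⟩ : ∃ j, C < |θ.coef j| := by
        by_contra! hcon
        exact hθ ⟨hr, hcon⟩
      have hjθ : j ∈ θ.1 := by
        by_contra hn
        rw [coef_of_notMem hn, abs_zero] at hj
        linarith
      simp only [Set.mem_iUnion]
      exact ⟨θ.1, Finset.mem_filter.2 ⟨Finset.mem_univ _, hr⟩, j, hjθ, rfl, hj⟩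
    · exact Or.inl (not_le.1 hr)
  have hγ : ∀ γ ∈ F, π (⋃ j ∈ γ, (modelEvent γ ∩ {θ | C < |θ.coef j|})) ≤
      ENNReal.ofReal r * e * π (modelEvent γ) := by
    intro γ hγ
    have hγr : (γ.card : ℝ) ≤ r := (Finset.mem_filter.1 hγ).2
    calc _ ≤ ∑ j ∈ γ, π (modelEvent γ ∩ {θ | C < |θ.coef j|}) := measure_biUnion_finset_le _ _
      _ ≤ ∑ j ∈ γ, e * π (modelEvent γ) := by
          refine Finset.sum_le_sum fun j hj => ?_
          rw [← ProbabilityTheory.cond_mul_eq_inter (measurableSet_modelEvent γ)]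
          gcongr
          exact h2 γ hγr j hj
      _ = γ.card * (e * π (modelEvent γ)) := by rw [Finset.sum_const, nsmul_eq_mul]
      _ ≤ _ := by
          rw [mul_assoc, ← ENNReal.ofReal_natCast]
          gcongr
  calc π (sieve K r C)ᶜ ≤ π {θ | r < (θ.1.card : ℝ)} +
        π (⋃ γ ∈ F, ⋃ j ∈ γ, (modelEvent γ ∩ {θ | C < |θ.coef j|})) :=
        (measure_mono hsub).trans (measure_union_le _ _)
    _ ≤ e + ∑ γ ∈ F, ENNReal.ofReal r * e * π (modelEvent γ) := by
        gcongr
        exact (measure_biUnion_finset_le _ _).trans (Finset.sum_le_sum hγ)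
    _ ≤ e + ENNReal.ofReal r * e * 1 := by
        rw [← Finset.mul_sum]
        gcongr
        exact sum_measure_modelEvent_le_one π F
    _ = _ := by ring

end Param

/-! ### Posterior probabilities, and prior mass near the truth -/

namespace GLM

variable (M : GLM) {K : ℕ} (νx : Measure (Fin K → ℝ))

instance isProbabilityMeasure_dataLaw [IsProbabilityMeasure νx]
    (β : Fin K → ℝ) (n : ℕ) :
    IsProbabilityMeasure (M.dataLaw νx β n) :=
  inferInstanceAs (IsProbabilityMeasure (Measure.pi fun _ : Fin n => M.obsLaw νx β))

theorem measurable_posterior_apply (prior : Measure (Param K)) [IsProbabilityMeasure prior]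
    (n : ℕ) (B : Set (Param K)) :
    Measurable fun w : Fin n → (Fin K → ℝ) × ℝ => M.posterior prior w B := by
  have hm := measurable_uncurry_prod (M.measurable_ratio_coef_uncurry (0 : Fin K → ℝ)) n
  have h : ∀ w : Fin n → (Fin K → ℝ) × ℝ, M.posterior prior w B = _ :=
    fun w => M.posterior_apply prior 0 w B
  simp_rw [h]
  have hZ : Measurable fun w : Fin n → (Fin K → ℝ) × ℝ =>
      ∫⁻ θ : Param K, ∏ i, M.ratio 0 θ.coef (w i) ∂prior := hm.lintegral_prod_left
  have hU : Measurable fun w : Fin n → (Fin K → ℝ) × ℝ =>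
      ∫⁻ θ : Param K in B, ∏ i, M.ratio 0 θ.coef (w i) ∂prior := hm.lintegral_prod_left
  exact hZ.inv.mul hU

/-- The normalizing integral has mean one, hence is almost surely finite; it is nonzero because all
density ratios are positive. -/
theorem posterior_univ_ae [IsProbabilityMeasure νx]
    (prior : Measure (Param K)) [IsProbabilityMeasure prior]
    (β : Fin K → ℝ) (n : ℕ) :
    ∀ᵐ w ∂(M.dataLaw νx β n), M.posterior prior w Set.univ = 1 := by
  have hg := M.measurable_ratio_coef_uncurry β
  have hm := measurable_uncurry_prod hg n
  have hE := lintegral_setLIntegral_prod_eq (M.obsLaw νx β) prior hg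
    (fun θ => M.lintegral_ratio νx β θ.coef) Set.univ n
  simp_rw [Measure.restrict_univ] at hE
  have hfin := ae_lt_top (μ := Measure.pi fun _ : Fin n => M.obsLaw νx β)
    hm.lintegral_prod_left (by rw [hE]; exact measure_ne_top _ _)
  filter_upwards [hfin] with w hw
  rw [M.posterior_apply prior β, Measure.restrict_univ]
  refine ENNReal.inv_mul_cancel (fun h0 => ?_) hw.ne
  rw [lintegral_eq_zero_iff hm.of_uncurry_right] at h0
  have : ∀ᵐ _ ∂prior, False := h0.mono fun θ hθ =>
    Finset.prod_ne_zero_iff.2 (fun i _ => M.ratio_ne_zero β θ.coef (w i)) hθ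
  exact IsProbabilityMeasure.ne_zero prior (by simpa using this)

/-- Markov's inequality for the posterior probability of a set. -/
theorem dataLaw_posterior_ge_le (prior : Measure (Param K)) [IsProbabilityMeasure prior]
    (β : Fin K → ℝ) (n : ℕ) (B : Set (Param K)) {t : ℝ}
    (h : ∫⁻ w, M.posterior prior w B ∂(M.dataLaw νx β n) ≤
      ENNReal.ofReal (4 * Real.exp (-t / 2))) :
    M.dataLaw νx β n {w | ENNReal.ofReal (2 * Real.exp (-t / 4)) ≤ M.posterior prior w B} ≤
      ENNReal.ofReal (2 * Real.exp (-t / 4)) := by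
  have hpos : 0 < 2 * Real.exp (-t / 4) := by positivity
  refine (meas_ge_le_lintegral_div (M.measurable_posterior_apply prior n B).aemeasurable
    (by simpa using Real.exp_pos _) ENNReal.ofReal_ne_top).trans ?_
  refine ENNReal.div_le_of_le_mul (h.trans (le_of_eq ?_))
  -- `4 e^{-t/2}` is the square of the threshold `2 e^{-t/4}`.
  rw [← ENNReal.ofReal_mul hpos.le, mul_mul_mul_comm, ← Real.exp_add]
  congr 2
  · norm_num
  · congr 1
    ring

/-- Almost surely one of the two events occurs, because the posterior has mass one. Subadditivity
replaces complements, so `G` and `B` need not be measurable. -/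
theorem one_le_dataLaw_posterior_add [IsProbabilityMeasure νx]
    (prior : Measure (Param K)) [IsProbabilityMeasure prior]
    (β : Fin K → ℝ) (n : ℕ) (G B : Set (Param K)) (hGB : G ∪ B = Set.univ) {u : ℝ} (hu : 0 ≤ u) :
    1 ≤ M.dataLaw νx β n {w | ENNReal.ofReal (1 - u) ≤ M.posterior prior w G} +
      M.dataLaw νx β n {w | ENNReal.ofReal u ≤ M.posterior prior w B} := by
  refine le_trans ?_ (measure_union_le _ _)
  rw [← measure_univ (μ := M.dataLaw νx β n)]
  refine measure_mono_ae ?_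
  filter_upwards [M.posterior_univ_ae νx prior β n] with w hw _
  by_contra hcon
  have hcon' : ¬(ENNReal.ofReal (1 - u) ≤ M.posterior prior w G ∨
    ENNReal.ofReal u ≤ M.posterior prior w B) := hcon
  rw [not_or, not_le, not_le] at hcon'
  have h1 : (1 : ℝ≥0∞) ≤ M.posterior prior w G + M.posterior prior w B := by
    rw [← hw, ← hGB]
    exact measure_union_le _ _
  have h2 := h1.trans_lt (ENNReal.add_lt_add hcon'.1 hcon'.2)
  rcases le_total u 1 with h | h
  · rw [← ENNReal.ofReal_add (by linarith) hu] at h2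
    simp at h2
  · rw [ENNReal.ofReal_of_nonpos (by linarith : 1 - u ≤ 0)] at hcon'
    exact absurd hcon'.1 not_lt_zero

/-- The prior mass of a neighborhood of the truth and the second moments of the density ratios
inside it. -/
theorem exists_neighborhood [IsProbabilityMeasure νx]
    (hx : ∀ᵐ x ∂νx, ∀ j, |x j| ≤ 1) (β₀ : Fin K → ℝ)
    (prior : Measure (Param K)) [IsProbabilityMeasure prior] {H δ L ε η t : ℝ} (hL : 0 < L)
    (hchi : ∀ h₀ h : ℝ, |h₀| ≤ H → |h - h₀| ≤ δ →
      ∫⁻ y, ENNReal.ofReal (M.f y h₀ * (M.f y h₀ / M.f y h)) ∂M.ν ≤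
        ENNReal.ofReal (Real.exp (L * |h - h₀|)))
    (hH : ∑ j, |β₀ j| ≤ H) (hε : 0 < ε) (hε1 : ε ≤ 1) (hη : 0 < η) (hηδ : 2 * η ≤ δ)
    (hηL : 8 * L * η ≤ 1) {γ : Finset (Fin K)} (hγ : γ.Nonempty)
    (htail : ∑ j ∈ γᶜ, |β₀ j| ≤ η * ε ^ 2)
    (h1 : ENNReal.ofReal (Real.exp (-t / 8)) ≤ prior (modelEvent γ))
    (h2 : ENNReal.ofReal (Real.exp (-t / 8)) ≤ ProbabilityTheory.cond prior (modelEvent γ)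
      {θ | ∀ j ∈ γ, |θ.coef j - β₀ j| < η * ε ^ 2 / γ.card}) :
    ∃ A : Set (Param K), MeasurableSet A ∧ ENNReal.ofReal (Real.exp (-t / 4)) ≤ prior A ∧
      ∀ θ ∈ A, ∫⁻ z, (M.ratio β₀ θ.coef z)⁻¹ ∂(M.obsLaw νx β₀) ≤
        ENNReal.ofReal (Real.exp (ε ^ 2 / 4)) := by
  have hε2 : ε ^ 2 ≤ 1 := pow_le_one₀ hε.le hε1
  have hε0 : 0 < ε ^ 2 := by positivity
  refine ⟨modelEvent γ ∩ {θ | ∀ j ∈ γ, |θ.coef j - β₀ j| < η * ε ^ 2 / γ.card},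
    (Param.measurableSet_modelEvent γ).inter (Param.measurableSet_neighborhood γ β₀ _), ?_,
    fun θ hθ => ?_⟩
  · rw [← ProbabilityTheory.cond_mul_eq_inter (Param.measurableSet_modelEvent γ)]
    calc _ = ENNReal.ofReal (Real.exp (-t / 8)) * ENNReal.ofReal (Real.exp (-t / 8)) := by
          rw [← ENNReal.ofReal_mul (Real.exp_pos _).le, ← Real.exp_add]
          congr 2
          ring
      _ ≤ _ := by gcongr
  · have hcard : (0 : ℝ) < γ.card := by exact_mod_cast hγ.card_pos
    -- One `η ε²` comes from the coefficients in `γ`, the other from the tail of `β₀` outside `γ`.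
    have hsum : ∑ j, |θ.coef j - β₀ j| ≤ 2 * η * ε ^ 2 := by
      rw [← Finset.sum_add_sum_compl γ]
      have h3 : ∑ j ∈ γ, |θ.coef j - β₀ j| ≤ η * ε ^ 2 := by
        refine (Finset.sum_le_card_nsmul γ _ _ fun j hj => (hθ.2 j hj).le).trans (le_of_eq ?_)
        rw [nsmul_eq_mul]
        field_simp
      have h4 : ∑ j ∈ γᶜ, |θ.coef j - β₀ j| = ∑ j ∈ γᶜ, |β₀ j| := by
        refine Finset.sum_congr rfl fun j hj => ?_
        have hθγ : θ.1 = γ := hθ.1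
        rw [Param.coef_of_notMem (by rw [hθγ]; exact Finset.mem_compl.1 hj), zero_sub, abs_neg]
      linarith
    refine (M.lintegral_inv_ratio_le νx hL.le hchi (s := 2 * η * ε ^ 2) ?_ ?_ ?_).trans ?_
    · filter_upwards [hx] with x hx
      exact (abs_linPred_le hx β₀).trans hH
    · nlinarith
    · filter_upwards [hx] with x hx
      exact (abs_linPred_sub_le hx _ _).trans hsum
    · apply ENNReal.ofReal_le_ofReal
      apply Real.exp_le_exp.2
      nlinarith

end GLM

/-! ### Asymptotics and the theorem -/

theorem Prec.eventually_le {u v : ℕ → ℝ} (h : Prec u v) (hv : ∀ᶠ n in atTop, 0 < v n) {c : ℝ}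
    (hc : 0 < c) : ∀ᶠ n in atTop, u n ≤ c * v n := by
  filter_upwards [h.eventually_lt_const hc, hv] with n h1 h2
  exact ((div_lt_iff₀ h2).1 h1).le

/-- The expected posterior mass outside a Hellinger ball of radius `4 * ε n`. -/
theorem eventually_lintegral_posterior_le (M : GLM) (K : ℕ → ℕ)
    (νx : ∀ n, Measure (Fin (K n) → ℝ)) [∀ n, IsProbabilityMeasure (νx n)]
    (hx : ∀ n, ∀ᵐ x ∂(νx n), ∀ j, |x j| ≤ 1)
    (βstar : ∀ n, Fin (K n) → ℝ)
    (hβ : ∃ B : ℝ, Tendsto (fun n => ∑ j, |βstar n j|) atTop (𝓝 B))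
    (prior : ∀ n, Measure (Param (K n))) [∀ n, IsProbabilityMeasure (prior n)]
    (ε : ℕ → ℝ) (hε : ∀ n, 0 < ε n ∧ ε n ≤ 1)
    (hnε : Tendsto (fun n : ℕ => (n : ℝ) * ε n ^ 2) atTop atTop)
    (hN : ConditionN βstar prior ε) (hO : ConditionO M prior ε) :
    ∀ᶠ n : ℕ in atTop,
      ∫⁻ w, M.posterior (prior n) w {θ | 4 * ε n < M.hellinger (νx n) θ.coef (βstar n)}
          ∂(M.dataLaw (νx n) (βstar n) n) ≤
        ENNReal.ofReal (4 * Real.exp (-(n * ε n ^ 2) / 2)) := by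
  obtain ⟨B, hB⟩ := hβ
  obtain ⟨γ, hγ, htail, η₀, hη₀, hN⟩ := hN
  obtain ⟨C, r, hC, hr, hO1, hO2, hO3, hO4⟩ := hO
  -- The `ℓ¹` norms of the true coefficients eventually stay below `|B| + 1`, so `δ` and `L` do not
  -- depend on `n`.
  obtain ⟨δ, hδ, L, hL, hchi⟩ := M.exists_lintegral_sq_div_le (|B| + 1) (by positivity)
  -- Three demands: `η < η₀`; linear parameters within `2 η ε² ≤ δ`; and exponent `2 L η ε² ≤ ε² /
  -- 4`.
  set η := min (η₀ / 2) (min (δ / 2) (1 / (8 * L))) with hη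
  have hη0 : 0 < η := by positivity
  have hη1 : η < η₀ := (min_le_left _ _).trans_lt (by linarith)
  have hη2 : 2 * η ≤ δ := by
    have : η ≤ δ / 2 := (min_le_right _ _).trans (min_le_left _ _)
    linarith
  have hη3 : 8 * L * η ≤ 1 := by
    have : η ≤ 1 / (8 * L) := (min_le_right _ _).trans (min_le_right _ _)
    rw [le_div_iff₀ (by positivity)] at this
    linarith
  obtain ⟨N, hN⟩ := hN η hη0 hη1
  have htpos : ∀ᶠ n : ℕ in atTop, 0 < (n : ℝ) * ε n ^ 2 := hnε.eventually_gt_atTop 0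
  filter_upwards [eventually_gt_atTop N, hO4, hnε.eventually_ge_atTop 4, htpos,
    hO1.eventually_le htpos (c := 1 / 8) (by norm_num),
    hO2.eventually_le htpos (c := 1 / 8) (by norm_num),
    hO3.eventually_le htpos (c := 1 / 8) (by norm_num),
    htail.eventually_le (.of_forall fun n => pow_pos (hε n).1 2) hη0,
    hB.eventually_le_const (show B < |B| + 1 by linarith [le_abs_self B])]
    with n hnN hO4 ht4 ht0 h1 h2 h3 htail hH
  obtain ⟨hε0, hε1⟩ := hε n
  have hr1 := (hr n).1
  have hr0 : 0 < r n := by linarith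
  have hK2 : 2 ≤ K n := by
    have : (1 : ℝ) < K n := hr1.trans_lt (hr n).2
    exact_mod_cast this
  have hlogK : Real.log 2 ≤ Real.log (K n) := Real.log_le_log (by norm_num) (by exact_mod_cast hK2)
  have hlog2 := Real.log_two_gt_d9
  have hlog5 : Real.log 5 ≤ 3 * Real.log (K n) := by
    have h8 : Real.log 5 ≤ 3 * Real.log 2 := by
      rw [← Real.log_rpow (by norm_num)]
      exact Real.log_le_log (by norm_num) (by norm_num)
    linarith
  have hr5 : r n * Real.log 5 ≤ r n * (3 * Real.log (K n)) := by gcongr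
  have hD := M.one_le_D (mul_pos hr0 (hC n)).le
  have hD0 : 0 < M.D (r n * C n) := by linarith
  set t := (n : ℝ) * ε n ^ 2 with ht
  have hcard : ((Param.cellIndex (K n) ⌊r n⌋₊ ⌈M.D (r n * C n) / ε n ^ 2⌉).card : ℝ) ≤
      Real.exp t := by
    refine (Param.card_cellIndex_le_exp (by omega) hr0.le ?_).trans ?_
    · rw [one_le_div (by positivity)]
      exact (pow_le_one₀ hε0.le hε1).trans hD
    · apply Real.exp_le_exp.2
      have hq : Real.log (M.D (r n * C n) / ε n ^ 2) =
          Real.log (M.D (r n * C n)) + Real.log (1 / ε n ^ 2) := by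
        rw [← Real.log_mul hD0.ne' (by positivity)]
        congr 1
        ring
      -- As `log 5 ≤ 3 log K`, the exponent is at most `1 + (1 + 3 + 1 + 1) t / 8 ≤ t`, using `t ≥
      -- 4`.
      rw [hq]
      linarith
  -- `log K ≥ log 2 > 1/2` turns `r log K ≤ t / 8` into `r ≤ t / 4`.
  have hrt : 1 + r n ≤ Real.exp t := by
    have h4 : r n * (1 / 2) ≤ r n * Real.log (K n) := by
      gcongr
      linarith
    linarith [Real.add_one_le_exp t]
  have hsieve : prior n (Param.sieve (K n) (r n) (C n))ᶜ ≤ ENNReal.ofReal (Real.exp (-3 * t)) := by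
    refine (Param.measure_compl_sieve_le (prior n) (hC n).le hO4.1 hO4.2).trans ?_
    rw [← ENNReal.ofReal_one, ← ENNReal.ofReal_add zero_le_one hr0.le,
      ← ENNReal.ofReal_mul (by linarith)]
    apply ENNReal.ofReal_le_ofReal
    calc (1 + r n) * Real.exp (-4 * t) ≤ Real.exp t * Real.exp (-4 * t) := by gcongr
      _ = Real.exp (-3 * t) := by
          rw [← Real.exp_add]
          congr 1
          ring
  obtain ⟨A, hA, hpriorA, hAchi⟩ := M.exists_neighborhood (νx n) (hx n) (βstar n) (prior n) hL hchi
    hH hε0 hε1 hη0 hη2 hη3 (hγ n) htail (hN n hnN).1 (hN n hnN).2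
  refine (M.lintegral_posterior_hellinger_le (νx n) (hx n) (βstar n) (prior n) hr0 (hC n) hε0 ht
    hcard hsieve hA hpriorA hAchi).trans ?_
  rw [← ENNReal.ofReal_add (by positivity) (by positivity),
    ← ENNReal.ofReal_add (by positivity) (by positivity)]
  apply ENNReal.ofReal_le_ofReal
  have h5 : Real.exp (-2 * t) ≤ Real.exp (-t / 2) := Real.exp_le_exp.2 (by linarith)
  linarith [Real.exp_pos (-t / 2)]

theorem theorem4 (M : GLM) (K : ℕ → ℕ)
    (νx : ∀ n, Measure (Fin (K n) → ℝ)) [∀ n, IsProbabilityMeasure (νx n)]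
    (hx : ∀ n, ∀ᵐ x ∂(νx n), ∀ j, |x j| ≤ 1)
    (βstar : ∀ n, Fin (K n) → ℝ)
    (hβ : ∃ B : ℝ, Tendsto (fun n => ∑ j, |βstar n j|) atTop (𝓝 B))
    (prior : ∀ n, Measure (Param (K n))) [∀ n, IsProbabilityMeasure (prior n)]
    (ε : ℕ → ℝ) (hε : ∀ n, 0 < ε n ∧ ε n ≤ 1)
    (hnε : Tendsto (fun n : ℕ => (n : ℝ) * ε n ^ 2) atTop atTop)
    (hN : ConditionN βstar prior ε) (hO : ConditionO M prior ε) :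
    Tendsto (fun n : ℕ => M.dataLaw (νx n) (βstar n) n
        {w | ENNReal.ofReal (1 - 2 * Real.exp (-(n * ε n ^ 2) / 4)) ≤
          M.posterior (prior n) w {θ | M.hellinger (νx n) θ.coef (βstar n) ≤ 4 * ε n}})
      atTop (𝓝 1) ∧
    (∀ᶠ n : ℕ in atTop, M.dataLaw (νx n) (βstar n) n
        {w | ENNReal.ofReal (2 * Real.exp (-(n * ε n ^ 2) / 4)) ≤
          M.posterior (prior n) w {θ | 4 * ε n < M.hellinger (νx n) θ.coef (βstar n)}} ≤
      ENNReal.ofReal (2 * Real.exp (-(n * ε n ^ 2) / 4))) ∧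
    (∀ᶠ n : ℕ in atTop,
      ∫⁻ w, M.posterior (prior n) w {θ | 4 * ε n < M.hellinger (νx n) θ.coef (βstar n)}
          ∂(M.dataLaw (νx n) (βstar n) n) ≤
        ENNReal.ofReal (4 * Real.exp (-(n * ε n ^ 2) / 2))) := by
  have h3 := eventually_lintegral_posterior_le M K νx hx βstar hβ prior ε hε hnε hN hO
  have h2 := h3.mono fun n hn => M.dataLaw_posterior_ge_le (νx n) (prior n) (βstar n) n _ hn
  refine ⟨?_, h2, h3⟩
  have hzero : Tendsto (fun n : ℕ => ENNReal.ofReal (2 * Real.exp (-(n * ε n ^ 2) / 4))) atTop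
      (𝓝 0) := by
    have h4 : Tendsto (fun n : ℕ => -((n : ℝ) * ε n ^ 2) / 4) atTop atBot :=
      (tendsto_neg_atTop_atBot.comp hnε).atBot_div_const (by norm_num)
    have h5 := (Real.tendsto_exp_atBot.comp h4).const_mul 2
    rw [mul_zero] at h5
    rw [← ENNReal.ofReal_zero]
    exact ENNReal.tendsto_ofReal h5
  have hlow : Tendsto (fun n : ℕ => 1 - ENNReal.ofReal (2 * Real.exp (-(n * ε n ^ 2) / 4))) atTop
      (𝓝 1) := by
    simpa using ENNReal.Tendsto.sub tendsto_const_nhds hzero (Or.inl ENNReal.one_ne_top)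
  refine tendsto_of_tendsto_of_tendsto_of_le_of_le' hlow tendsto_const_nhds ?_
    (.of_forall fun n => prob_le_one)
  filter_upwards [h2] with n hn
  rw [tsub_le_iff_right]
  refine (M.one_le_dataLaw_posterior_add (νx n) (prior n) (βstar n) n _
    {θ | 4 * ε n < M.hellinger (νx n) θ.coef (βstar n)} ?_ (by positivity)).trans
    (add_le_add le_rfl hn)
  ext θ
  simpa using le_or_gt _ _

end
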